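/- Let $n\ge 1$ and let $\Gamma=\{(\alpha_1,\dots,\alpha_n)\in\mathbb{R}^n: 0\le\alpha_n\le\dots\le\alpha_1\le 1\}$, with Lebesgue measure $\lambda$ normalized so that $\lambda(\Gamma)=1$. Define $(n+1)\times(n+1)$ matrices as follows. $V$ has entries $0$, except those in position $ij$ with $i=n+1$, or with $j\ge 2$ and $i+j\le n+2$, which are $1$. For $a=0,1$, the matrix $A_a$ has entries $0$, except those in position $(a+1)\,1$, in positions $1\,(n+1)$ and $2\,(n+1)$, and in positions $(j+1)\,j$ for $2\le j\le n$, which are $1$. $B_a$ is $A_a$ with the two entries $1$ of the last column replaced by $1/2$, and $D_a=VB_aV^{-1}$. Let $\tau_a:\Gamma\to\Gamma$ be the affine map such that $\tau_a(\alpha)=\beta$ iff $D_a(\alpha_1\cdots\alpha_n\,1)^{tr}=(\beta_1\cdots\beta_n\,1)^{tr}$. Let $v_i$ be the vertex of $\Gamma$ whose projective coordinates are the $(i+1)$th column of $V$, for $0\le i\le n$ (so $v_0=0$), let $v_{-1}$ be the only point of $\Gamma$ such that $(v_{-1},1)^{tr}$ is an eigenvector of $D_1$, and let $\Gamma^o$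 be the set of all $\sum_{i=0}^n x_iv_i$ with $x_i\ge 0$, $\sum x_i=1$, $x_0>0$. The sets $\{v_{-1}\}$ and $\tau_1^k\tau_0\Gamma^o$, $k\ge0$, partition $\Gamma$; the map $K:\Gamma\to\Gamma$ is defined by $Kv_{-1}=v_0$ and $K=\tau_0^k\tau_1(\tau_1^k\tau_0)^{-1}$ on $\tau_1^k\tau_0\Gamma^o$. Let $\mu$ be the normalized Haar measure on the group $\mathbb{Z}_2$ of $2$-adic integers. Then the following hold. 1. For every $k\ge 0$, on $\tau_1^k\tau_0\Gamma^o$ the map $K$ coincides with an affine map $\mathbb{R}^n\to\mathbb{R}^n$ whose linear part has determinant $1$ or $-1$; and $K$ is a measurable map that preserves $\lambda$. 2. For every $\mathbf{a}=\sum_{t\ge0}a_t2^t\in\mathbb{Z}_2$ with $a_t\in\{0,1\}$, the set $\bigcap_{t\ge0}\tau_{a_0}\tau_{a_1}\cdots\tau_{a_{t-1}}\Gamma$ consists of exactly one point $\upsilon(\mathbf{a})$. There is a Borel set $N\subset\Gamma$ with $\lambda(N)=0$ and $K^{-1}N=N$ such that $\upsilon$ is a metric isomorphism between the measure-preserving systems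 $(\mathbb{Z}_2,\mu,+1)$ and $(\Gamma,\lambda,K)$ off $N$. That is, with $X=\Gamma\setminus N$: the sets $\upsilon^{-1}X$ and $X$ are Borel of full measure and forward invariant under $+1$ and $K$, respectively; $\upsilon$ restricts to a measure-preserving bijection $\upsilon^{-1}X\to X$, Borel in both directions; and $\upsilon(\mathbf{a}+1)=K\upsilon(\mathbf{a})$ for every $\mathbf{a}\in\upsilon^{-1}X$. -/

import Mathlib

open MeasureTheory

namespace KvN

/-! ### The matrices and the simplex (indices start from `0`) -/

/-- The matrix `V`. -/
def V (n : ℕ) : Matrix (Fin (n + 1)) (Fin (n + 1)) ℝ := fun i j =>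
  if i.val = n ∨ (1 ≤ j.val ∧ i.val + j.val ≤ n) then 1 else 0

/-- The matrices `A_0` and `A_1`. -/
def A (n : ℕ) (a : Fin 2) : Matrix (Fin (n + 1)) (Fin (n + 1)) ℝ := fun i j =>
  if (j.val = 0 ∧ i.val = a.val) ∨ (j.val = n ∧ (i.val = 0 ∨ i.val = 1)) ∨
      (1 ≤ j.val ∧ i.val = j.val + 1) then 1 else 0

/-- `B_a` is `A_a` with the two entries `1` in the last column replaced by `1/2`. -/
noncomputable def B (n : ℕ) (a : Fin 2) : Matrix (Fin (n + 1)) (Fin (n + 1)) ℝ := fun i j =>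
  if j.val = n then A n a i j / 2 else A n a i j

/-- `D_a = V B_a V⁻¹`. -/
noncomputable def D (n : ℕ) (a : Fin 2) : Matrix (Fin (n + 1)) (Fin (n + 1)) ℝ :=
  V n * B n a * (V n)⁻¹

/-- The simplex `Γ = {α : 0 ≤ α_n ≤ ⋯ ≤ α_1 ≤ 1}` in `ℝⁿ`. -/
def Gam (n : ℕ) : Set (Fin n → ℝ) := {p | (∀ i, 0 ≤ p i ∧ p i ≤ 1) ∧ Antitone p}

/-- Projective coordinates `(α_1, …, α_n, 1)`. -/
def hom {n : ℕ} (p : Fin n → ℝ) : Fin (n + 1) → ℝ := Fin.snoc (α := fun _ => ℝ) p 1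

/-- The vertex `v_i` of `Γ`, in affine coordinates: the `i`th column of `V`. -/
def vertex (n : ℕ) (i : Fin (n + 1)) : Fin n → ℝ := fun j => V n j.castSucc i

/-! ### `D_a` maps `Γ` to itself -/

theorem V_mulVec (n : ℕ) (x : Fin (n + 1) → ℝ) (i : Fin (n + 1)) :
    (V n).mulVec x i =
      ∑ j, if i.val = n ∨ (1 ≤ j.val ∧ i.val + j.val ≤ n) then x j else 0 := by
  simp [Matrix.mulVec, dotProduct, V]

theorem V_last (n : ℕ) (x : Fin (n + 1) → ℝ) : (V n).mulVec x (Fin.last n) = ∑ j, x j := by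
  simp [V_mulVec]

theorem V_step (n : ℕ) (x : Fin (n + 1) → ℝ) (i i' j : Fin (n + 1)) (hi : i'.val = i.val + 1)
    (hi' : i'.val < n) (hj : i.val + j.val = n) :
    (V n).mulVec x i - (V n).mulVec x i' = x j := by
  rw [V_mulVec, V_mulVec, ← Finset.sum_sub_distrib, Finset.sum_eq_single j]
  · rw [if_pos (by omega), if_neg (by omega)]; simp
  · intro k _ hk
    have hk' : k.val ≠ j.val := fun h => hk (Fin.ext h)
    by_cases h : 1 ≤ k.val ∧ i.val + k.val ≤ n
    · rw [if_pos (by omega), if_pos (by omega)]; simp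
    · rw [if_neg (by omega), if_neg (by omega)]; simp
  · simp

theorem V_penult (n : ℕ) (x : Fin (n + 1) → ℝ) (i j : Fin (n + 1)) (hi : i.val + 1 = n)
    (hj : j.val = 1) : (V n).mulVec x i = x j := by
  rw [V_mulVec, Finset.sum_eq_single j]
  · rw [if_pos (by omega)]
  · intro k _ hk
    have hk' : k.val ≠ j.val := fun h => hk (Fin.ext h)
    rw [if_neg (by omega)]
  · simp

theorem V_first (n : ℕ) (hn : 1 ≤ n) (x : Fin (n + 1) → ℝ) :
    (V n).mulVec x (Fin.last n) - (V n).mulVec x 0 = x 0 := by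
  rw [V_mulVec, V_mulVec, ← Finset.sum_sub_distrib, Finset.sum_eq_single 0]
  · rw [if_pos (by simp), if_neg (by simp; omega)]; simp
  · intro k _ hk
    have hk' : k.val ≠ 0 := fun h => hk (Fin.ext h)
    rw [if_pos (by simp), if_pos (by have := k.isLt; simp; omega)]; simp
  · simp

theorem V_isUnit (n : ℕ) (hn : 1 ≤ n) : IsUnit (V n) := by
  rw [← Matrix.mulVec_injective_iff_isUnit]
  intro x y hxy
  have hz : (V n).mulVec (x - y) = 0 := by rw [Matrix.mulVec_sub]; exact sub_eq_zero.2 hxy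
  have h0 : ∀ i, (V n).mulVec (x - y) i = 0 := fun i => congrFun hz i
  rw [← sub_eq_zero]
  funext j
  by_cases hj0 : j.val = 0
  · have : j = 0 := Fin.ext hj0
    rw [this, ← V_first n hn (x - y), h0, h0]; simp
  by_cases hj1 : j.val = 1
  · rw [← V_penult n (x - y) ⟨n - 1, by omega⟩ j (by simp; omega) hj1, h0]; rfl
  · rw [← V_step n (x - y) ⟨n - j.val, by omega⟩ ⟨n - j.val + 1, by omega⟩ j rfl
      (by have := j.isLt; simp; omega) (by have := j.isLt; simp; omega), h0, h0]; simp

theorem V_inv_mulVec (n : ℕ) (hn : 1 ≤ n) (x : Fin (n + 1) → ℝ) :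
    (V n).mulVec ((V n)⁻¹.mulVec x) = x := by
  rw [Matrix.mulVec_mulVec, Matrix.mul_nonsing_inv _ ((Matrix.isUnit_iff_isUnit_det _).1
    (V_isUnit n hn)), Matrix.one_mulVec]

theorem hom_castSucc {n : ℕ} (p : Fin n → ℝ) (i : Fin n) : hom p i.castSucc = p i := by
  simp [hom]

theorem hom_last {n : ℕ} (p : Fin n → ℝ) : hom p (Fin.last n) = 1 := by
  simp [hom]

theorem hom_lt {n : ℕ} (p : Fin n → ℝ) (i : Fin (n + 1)) (h : i.val < n) :
    hom p i = p ⟨i.val, h⟩ := by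
  rw [← hom_castSucc p ⟨i.val, h⟩]; rfl

/-- Barycentric coordinates of points of `Γ` are nonnegative. -/
theorem bary_nonneg (n : ℕ) (hn : 1 ≤ n) (p : Fin n → ℝ) (hp : p ∈ Gam n) (j : Fin (n + 1)) :
    0 ≤ (V n)⁻¹.mulVec (hom p) j := by
  have hV := V_inv_mulVec n hn (hom p)
  set x := (V n)⁻¹.mulVec (hom p) with hx
  by_cases hj0 : j.val = 0
  · have : j = 0 := Fin.ext hj0
    rw [this, ← V_first n hn x, hV, hom_last, hom_lt p 0 (by simp; omega)]
    linarith [(hp.1 ⟨(0 : Fin (n + 1)).val, by simp; omega⟩).2]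
  by_cases hj1 : j.val = 1
  · rw [← V_penult n x ⟨n - 1, by omega⟩ j (by simp; omega) hj1, hV,
      hom_lt p _ (by simp; omega)]
    exact (hp.1 _).1
  · have hlt := j.isLt
    have e1 : n - j.val < n := by omega
    have e2 : n - j.val + 1 < n := by omega
    rw [← V_step n x ⟨n - j.val, by omega⟩ ⟨n - j.val + 1, by omega⟩ j rfl
      (by simp; omega) (by simp; omega), hV, hom_lt p ⟨n - j.val, _⟩ e1,
      hom_lt p ⟨n - j.val + 1, _⟩ e2]
    exact sub_nonneg.2 (hp.2 (by simp [Fin.le_def]))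

theorem B_colsum (n : ℕ) (hn : 1 ≤ n) (a : Fin 2) (j : Fin (n + 1)) : ∑ i, B n a i j = 1 := by
  have ha := a.isLt
  have hj := j.isLt
  by_cases h0 : j.val = 0
  · rw [Finset.sum_eq_single (⟨a.val, by omega⟩ : Fin (n + 1))]
    · simp only [B, A]; rw [if_neg (by omega), if_pos (by simp [h0])]
    · intro k _ hk
      have hk' : k.val ≠ a.val := fun h => hk (Fin.ext h)
      simp only [B, A]; rw [if_neg (by omega), if_neg (by omega)]
    · simp
  by_cases h1 : j.val = n
  · rw [Finset.sum_eq_add (⟨0, by omega⟩ : Fin (n + 1)) (⟨1, by omega⟩ : Fin (n + 1))]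
    · simp only [B, A]
      rw [if_pos h1, if_pos (by simp [h1]), if_pos h1, if_pos (by simp [h1])]; norm_num
    · simp
    · intro k _ hk
      have hk0 : k.val ≠ 0 := fun h => hk.1 (Fin.ext h)
      have hk1 : k.val ≠ 1 := fun h => hk.2 (Fin.ext h)
      simp only [B, A]; rw [if_pos h1, if_neg (by omega)]; simp
    · simp
    · simp
  · rw [Finset.sum_eq_single (⟨j.val + 1, by omega⟩ : Fin (n + 1))]
    · simp only [B, A]; rw [if_neg h1, if_pos (by simp; omega)]
    · intro k _ hk
      have hk' : k.val ≠ j.val + 1 := fun h => hk (Fin.ext h)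
      simp only [B, A]; rw [if_neg h1, if_neg (by omega)]
    · simp

theorem B_nonneg (n : ℕ) (a : Fin 2) (i j : Fin (n + 1)) : 0 ≤ B n a i j := by
  simp only [B, A]; split_ifs <;> norm_num

/-- Convex combinations of the vertices lie in `Γ`. -/
theorem mem_Gam_of_bary (n : ℕ) (y : Fin (n + 1) → ℝ) (hy : ∀ i, 0 ≤ y i) (hs : ∑ i, y i = 1) :
    (fun i : Fin n => (V n).mulVec y i.castSucc) ∈ Gam n := by
  refine ⟨fun i => ⟨?_, ?_⟩, fun i i' hii => ?_⟩
  · simp only [V_mulVec]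
    exact Finset.sum_nonneg fun j _ => by split_ifs <;> [exact hy j; exact le_rfl]
  · simp only [V_mulVec]
    rw [← hs]
    exact Finset.sum_le_sum fun j _ => by split_ifs <;> [exact le_rfl; exact hy j]
  · simp only [V_mulVec]
    refine Finset.sum_le_sum fun j _ => ?_
    have h1 : i.val ≤ i'.val := hii
    have h2 := i'.isLt
    by_cases h : 1 ≤ j.val ∧ i'.val + j.val ≤ n
    · rw [if_pos (by simp; omega), if_pos (by simp; omega)]
    · rw [if_neg (by simp; omega)]; split_ifs <;> [exact hy j; exact le_rfl]

theorem D_mulVec_bary (n : ℕ) (hn : 1 ≤ n) (a : Fin 2) (p : Fin n → ℝ) (hp : p ∈ Gam n) :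
    ∃ y : Fin (n + 1) → ℝ, (∀ i, 0 ≤ y i) ∧ ∑ i, y i = 1 ∧
      (D n a).mulVec (hom p) = (V n).mulVec y := by
  refine ⟨(B n a).mulVec ((V n)⁻¹.mulVec (hom p)), fun i => ?_, ?_, ?_⟩
  · simp only [Matrix.mulVec, dotProduct]
    exact Finset.sum_nonneg fun j _ => mul_nonneg (B_nonneg n a i j) (bary_nonneg n hn p hp j)
  · have h1 : ∑ j, (V n)⁻¹.mulVec (hom p) j = 1 := by
      rw [← V_last, V_inv_mulVec n hn, hom_last]
    simp only [Matrix.mulVec, dotProduct] at h1 ⊢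
    rw [Finset.sum_comm]
    simp only [← Finset.sum_mul, B_colsum n hn a, one_mul]
    exact h1
  · rw [D, Matrix.mulVec_mulVec, Matrix.mulVec_mulVec, Matrix.mul_assoc]

theorem D_mem_Gam (n : ℕ) (a : Fin 2) (p : Fin n → ℝ) (hp : p ∈ Gam n) :
    (fun i : Fin n => (D n a).mulVec (hom p) i.castSucc) ∈ Gam n := by
  rcases Nat.eq_zero_or_pos n with rfl | hn
  · exact ⟨fun i => i.elim0, fun i => i.elim0⟩
  · obtain ⟨y, hy, hs, h⟩ := D_mulVec_bary n hn a p hp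
    rw [h]
    exact mem_Gam_of_bary n y hy hs

/-! ### The maps `τ_0`, `τ_1` and `K` -/

/-- The affine map `τ_a : Γ → Γ` determined by `D_a`. -/
noncomputable def tau (n : ℕ) (a : Fin 2) (p : Gam n) : Gam n :=
  ⟨fun i => (D n a).mulVec (hom p.1) i.castSucc, D_mem_Gam n a p.1 p.2⟩

/-- `τ_a p = q` means `D_a (p, 1) = (q, 1)` in projective coordinates. -/
theorem hom_tau (n : ℕ) (hn : 1 ≤ n) (a : Fin 2) (p : Gam n) :
    hom (tau n a p).1 = (D n a).mulVec (hom p.1) := by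
  funext i
  refine Fin.lastCases ?_ (fun i => ?_) i
  · obtain ⟨y, hy, hs, h⟩ := D_mulVec_bary n hn a p.1 p.2
    rw [hom_last, h, V_last, hs]
  · rw [hom_castSucc]; rfl

/-- The vertex `v_0 = (0, …, 0)`. -/
def v0 (n : ℕ) : Gam n :=
  ⟨vertex n 0, by
    have h : vertex n 0 = 0 := by
      funext i
      have := i.isLt
      simp only [vertex, V]
      rw [if_neg (by simp; omega)]; rfl
    rw [h]
    exact ⟨fun i => by simp, fun i j _ => le_rfl⟩⟩

/-- `p` is the point `v_{-1}` of `Γ`: its projective coordinates form an eigenvector of `D_1`. -/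
def IsVNegOne (n : ℕ) (p : Gam n) : Prop :=
  ∃ c : ℝ, (D n 1).mulVec (hom p.1) = c • hom p.1

/-- `Γ^o`: the points `∑ x_i v_i` with `x_i ≥ 0`, `∑ x_i = 1` and `x_0 > 0`. -/
def GamO (n : ℕ) : Set (Gam n) :=
  {p | ∃ x : Fin (n + 1) → ℝ, (∀ i, 0 ≤ x i) ∧ ∑ i, x i = 1 ∧ 0 < x 0 ∧
    p.1 = ∑ i, x i • vertex n i}

/-- The piece `τ_1^k τ_0 Γ^o`. -/
def piece (n k : ℕ) : Set (Gam n) := (fun q => (tau n 1)^[k] (tau n 0 q)) '' GamO n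

open Classical in
/-- The Kakutani-von Neumann map `K : Γ → Γ`: it sends `v_{-1}` to `v_0`, and a point
`p = τ_1^k τ_0 q`, with `q ∈ Γ^o`, to `τ_0^k τ_1 q`.
The sets `{v_{-1}}` and `τ_1^k τ_0 Γ^o`, `k ≥ 0`, partition `Γ` when `n ≥ 1`, and all `τ_a` are
injective, so `k` and `q` are unique and the last `else` is never reached. -/
noncomputable def K (n : ℕ) (p : Gam n) : Gam n :=
  if IsVNegOne n p then v0 n
  else if h : ∃ kq : ℕ × Gam n, kq.2 ∈ GamO n ∧ (tau n 1)^[kq.1] (tau n 0 kq.2) = p then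
    (tau n 0)^[h.choose.1] (tau n 1 h.choose.2)
  else p

/-- The Lebesgue measure on `Γ`, normalized so that `Γ` has measure `1`. -/
noncomputable def lam (n : ℕ) : Measure (Gam n) :=
  (volume (Gam n))⁻¹ • Measure.comap Subtype.val (volume : Measure (Fin n → ℝ))

/-! ### The adding machine and the coding map -/

noncomputable instance : MeasurableSpace ℤ_[2] := borel _

instance : BorelSpace ℤ_[2] := ⟨rfl⟩

/-- The Haar measure on `ℤ_2`, normalized so that `ℤ_2` has measure `1`. -/
noncomputable def haar : Measure ℤ_[2] := Measure.addHaarMeasure ⊤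

/-- The `t`th binary digit `a_t` of `a = ∑ a_t 2^t ∈ ℤ_2`; `a.appr (t + 1)` is the natural number
`< 2^(t+1)` congruent to `a` modulo `2^(t+1)`. -/
noncomputable def digit (a : ℤ_[2]) (t : ℕ) : Fin 2 :=
  ⟨a.appr (t + 1) / 2 ^ t % 2, Nat.mod_lt _ (by norm_num)⟩

/-- `τ_{a_0} τ_{a_1} ⋯ τ_{a_{t-1}}`. -/
noncomputable def tauWord (n : ℕ) (a : ℕ → Fin 2) : ℕ → Gam n → Gam n
  | 0 => id
  | t + 1 => tauWord n a t ∘ tau n (a t)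

/-- The simplex `Γ_{a_0 … a_{t-1}} = τ_{a_0} ⋯ τ_{a_{t-1}} Γ`. -/
def cell (n : ℕ) (a : ℕ → Fin 2) (t : ℕ) : Set (Gam n) := Set.range (tauWord n a t)

/-- `υ(a)`: the unique element of `⋂_t Γ_{a_0 … a_{t-1}}`. -/
noncomputable def upsilon (n : ℕ) (a : ℤ_[2]) : Gam n :=
  @Classical.epsilon (Gam n) ⟨v0 n⟩ fun p => p ∈ ⋂ t, cell n (digit a) t

/-! ### Metric isomorphism -/

/-- The map `φ`, restricted to `X'`, is a metric isomorphism between the measure-preserving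
systems `(X, μ, S)` and `(Y, ν, T)`: `X'` and `Y'` are forward-invariant sets of full measure, `φ`
restricts to a measure-preserving bijection `X' → Y'` with measurable inverse, and it intertwines
`S` and `T` on `X'`. -/
structure IsMetricIso {X Y : Type*} [MeasurableSpace X] [MeasurableSpace Y]
    (μ : Measure X) (S : X → X) (ν : Measure Y) (T : Y → Y) (φ : X → Y)
    (X' : Set X) (Y' : Set Y) : Prop where
  preserving_source : MeasurePreserving S μ μ
  preserving_target : MeasurePreserving T ν ν
  measurableSet_source : MeasurableSet X'
  measurableSet_target : MeasurableSet Y'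
  null_source : μ X'ᶜ = 0
  null_target : ν Y'ᶜ = 0
  mapsTo_source : Set.MapsTo S X' X'
  mapsTo_target : Set.MapsTo T Y' Y'
  equiv : ∃ e : X' ≃ᵐ Y', (∀ x : X', (e x : Y) = φ x) ∧
    MeasurePreserving e (μ.comap Subtype.val) (ν.comap Subtype.val)
  intertwine : ∀ x ∈ X', φ (S x) = T (φ x)

end KvN

/-! In barycentric coordinates for the vertices $v_0,\dots,v_n$, the map $\tau_a$ sends $v_0$ to
$v_a$, shifts $v_j$ to $v_{j+1}$ for $1\le j<n$, and sends $v_n$ to the midpoint of $v_0$ and $v_1$.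
Thus $\tau_0\Gamma$ and $\tau_1\Gamma$ are the two halves into which the hyperplane $x_0=x_1$ cuts
$\Gamma$, and the reflection exchanging $v_0$ and $v_1$ carries $\tau_0$ to $\tau_1$. The two
determinants therefore agree up to sign, and the halves have equal measure. Consequently each branch
$\tau_0^k\tau_1(\tau_1^k\tau_0)^{-1}$ of $K$ has determinant $\pm1$, and every cell
$\tau_{a_0}\cdots\tau_{a_{t-1}}\Gamma$ has measure $2^{-t}$ (`lam_cell`).

Cells shrink to points because the vertices other than the image of $v_0$ form a queue: at each step
the head is bisected against that apex, the midpoint joins the end, and the new apex is the old apex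
or the old head. Such a process contracts the diameter by a fixed factor every $n^2+n$ steps
(`diam_window_le`). Hence $\upsilon$ is well defined and continuous, and
$\upsilon(e+2b)=\tau_e\upsilon(b)$ (`upsilon_add_two_mul`).

The map $K$ obeys the same recursion as adding $1$: $K\tau_0=\tau_1$ on $\Gamma^o$, and
$K\tau_1=\tau_0K$ propagates the carry. So $K\upsilon(a)=\upsilon(a+1)$ when $\upsilon(a)$ avoids
the cell boundaries (`K_upsilon`). These boundaries are null, and off them addresses are unique, so
there cells correspond to residue classes modulo $2^t$. Both have measure $2^{-t}$, which identifies
$\lambda$ with Haar measure (`map_symm_lam`). Invariance of $\lambda$ under $K$ then follows from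
translation invariance through this conjugacy. -/

namespace KvN

/-! ### A contraction principle for bisection sequences -/

section Bisection

variable {E : Type*}

/-- The current window of a bisection process: the apex `p t` and the queue
`q t, …, q (t + n - 1)`. -/
def window (n : ℕ) (p q : ℕ → E) (t : ℕ) : Set E := insert (p t) (q '' Set.Ico t (t + n))

theorem window_finite (n : ℕ) (p q : ℕ → E) (t : ℕ) : (window n p q t).Finite :=
  ((Set.finite_Ico _ _).image _).insert _

variable {n : ℕ} {p q : ℕ → E}

/-- An apex that changes must become a queue element, and only one that was at the head since time
`r`. Its index is thus close to `r`, which the distance estimates exploit. -/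
theorem apex_eq_or (hp : ∀ t, p (t + 1) = p t ∨ p (t + 1) = q t) (r m : ℕ) :
    p (r + m) = p r ∨ ∃ u, r ≤ u ∧ u < r + m ∧ p (r + m) = q u := by
  induction m with
  | zero => exact Or.inl rfl
  | succ m ih =>
    rcases hp (r + m) with h | h
    · rcases ih with h' | ⟨u, h1, h2, h3⟩
      · exact Or.inl (h.trans h')
      · exact Or.inr ⟨u, h1, by omega, h.trans h3⟩
    · exact Or.inr ⟨r + m, by omega, by omega, h⟩

variable [NormedAddCommGroup E] [NormedSpace ℝ E]

theorem dist_midpoint_midpoint_le_half {a b c d : E} {x y : ℝ} (h₁ : dist a c ≤ x)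
    (h₂ : dist b d ≤ y) : dist (midpoint ℝ a b) (midpoint ℝ c d) ≤ (x + y) / 2 := by
  have h := dist_midpoint_midpoint_le a b c d
  linarith

variable (hn : 1 ≤ n) (hp : ∀ t, p (t + 1) = p t ∨ p (t + 1) = q t)
  (hq : ∀ t, q (t + n) = midpoint ℝ (p t) (q t))

include hn hp hq in
theorem convexHull_window_antitone : Antitone fun t => convexHull ℝ (window n p q t) := by
  refine antitone_nat_of_succ_le fun t => convexHull_min ?_ (convex_convexHull ℝ _)
  have hpt : p t ∈ convexHull ℝ (window n p q t) := subset_convexHull ℝ _ (Set.mem_insert _ _)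
  have hqt : ∀ j, t ≤ j → j < t + n → q j ∈ convexHull ℝ (window n p q t) := fun j h1 h2 =>
    subset_convexHull ℝ _ (Set.mem_insert_of_mem _ ⟨j, ⟨h1, h2⟩, rfl⟩)
  rintro x (rfl | ⟨j, ⟨h1, h2⟩, rfl⟩)
  · rcases hp t with h | h
    · rw [h]; exact hpt
    · rw [h]; exact hqt t le_rfl (by omega)
  · by_cases h : j < t + n
    · exact hqt j (by omega) h
    · obtain rfl : j = t + n := by omega
      rw [hq]
      exact (convex_convexHull ℝ _).midpoint_mem hpt (hqt t le_rfl (by omega))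

include hn hp hq in
theorem apex_mem_convexHull {T s : ℕ} (h : T ≤ s) : p s ∈ convexHull ℝ (window n p q T) :=
  convexHull_window_antitone hn hp hq h (subset_convexHull ℝ _ (Set.mem_insert _ _))

include hn hp hq in
theorem queue_mem_convexHull {T s : ℕ} (h : T ≤ s) : q s ∈ convexHull ℝ (window n p q T) :=
  convexHull_window_antitone hn hp hq h
    (subset_convexHull ℝ _ (Set.mem_insert_of_mem _ ⟨s, ⟨le_rfl, by omega⟩, rfl⟩))

theorem dist_le_diam_window {T : ℕ} {x y : E} (hx : x ∈ convexHull ℝ (window n p q T))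
    (hy : y ∈ convexHull ℝ (window n p q T)) : dist x y ≤ Metric.diam (window n p q T) := by
  rw [← convexHull_diam]
  exact Metric.dist_le_diam_of_mem
    (isBounded_convexHull.2 (window_finite n p q T).isBounded) hx hy

-- Both points are midpoints formed `n` steps earlier. If the apex did not change between the two
-- bisections, half of the difference cancels. Otherwise the later apex is a queue element `q u`
-- with `u - r ≤ g`; pairing it with `q r` uses the bound for the smaller gap, while the other pair
-- is bounded by the diameter. Averaging turns $1-2^{-g}$ into $1-2^{-(g+1)}$.
include hn hp hq in
theorem dist_queue_le (g : ℕ) : ∀ (T s g' : ℕ), T + g * n ≤ s → g' ≤ g →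
    dist (q s) (q (s + g')) ≤ (1 - (1 / 2) ^ g) * Metric.diam (window n p q T) := by
  induction g with
  | zero =>
    intro T s g' _ hg
    obtain rfl : g' = 0 := by omega
    simp
  | succ g ih =>
    intro T s g' hs hg
    rw [add_mul, one_mul] at hs
    set d := Metric.diam (window n p q T) with hd
    have hd0 : 0 ≤ d := Metric.diam_nonneg
    have hg1 : ((1 : ℝ) / 2) ^ g ≤ 1 := pow_le_one₀ (by norm_num) (by norm_num)
    have hg0 : 0 ≤ ((1 : ℝ) / 2) ^ g := by positivity
    rw [pow_succ]
    rcases Nat.lt_or_ge g g' with hlt | hle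
    · obtain rfl : g' = g + 1 := by omega
      obtain ⟨r, rfl⟩ : ∃ r, s = r + n := ⟨s - n, by omega⟩
      have hgn : T ≤ r := by have := Nat.zero_le (g * n); omega
      rw [hq, show r + n + (g + 1) = r + (g + 1) + n by ring, hq]
      have key : ∀ s s', T ≤ s → T ≤ s' → dist (q s) (q s') ≤ d := fun s s' h h' =>
        dist_le_diam_window (queue_mem_convexHull hn hp hq h) (queue_mem_convexHull hn hp hq h')
      rcases apex_eq_or hp r (g + 1) with h | ⟨u, h1, h2, h3⟩
      · have := dist_midpoint_midpoint_le_half (dist_self (p r)).le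
          (key r (r + (g + 1)) hgn (by omega))
        rw [h]
        nlinarith
      -- Swapping the endpoints of one midpoint pairs `q r` with `q u`, and `p r` with `q (r + (g +
      -- 1))`.
      · rw [h3, midpoint_comm]
        obtain ⟨m, rfl⟩ : ∃ m, u = r + m := ⟨u - r, by omega⟩
        have := dist_midpoint_midpoint_le_half (ih T r m (by omega) (by omega))
          (dist_le_diam_window (apex_mem_convexHull hn hp hq hgn)
            (queue_mem_convexHull hn hp hq (s := r + (g + 1)) (by omega)))
        nlinarith
    · have := ih T s g' (by omega) hle
      nlinarith

include hn hp hq in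
theorem dist_apex_queue_le {T t g : ℕ} (ht : T + n * n + n ≤ t) (hg : g < n) :
    dist (p t) (q (t + g)) ≤ (1 - (1 / 2) ^ (n + 1)) * Metric.diam (window n p q T) := by
  set d := Metric.diam (window n p q T) with hd
  have hd0 : 0 ≤ d := Metric.diam_nonneg
  have hg1 : ((1 : ℝ) / 2) ^ n ≤ 1 := pow_le_one₀ (by norm_num) (by norm_num)
  obtain ⟨r, hr⟩ : ∃ r, t + g = r + n := ⟨t + g - n, by omega⟩
  obtain ⟨m, rfl⟩ : ∃ m, t = r + m := ⟨t - r, by omega⟩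
  have hTr : T ≤ r := by have := Nat.zero_le (n * n); omega
  -- The apex is regarded as a degenerate midpoint, so that it can be compared half by half with the
  -- midpoint `q (r + n)`.
  rw [hr, hq, pow_succ, ← midpoint_self ℝ (p (r + m))]
  rcases apex_eq_or hp r m with h | ⟨u, h1, h2, h3⟩
  · rw [h]
    have := dist_midpoint_midpoint_le_half (dist_self (p r)).le
      (dist_le_diam_window (apex_mem_convexHull hn hp hq hTr) (queue_mem_convexHull hn hp hq hTr))
    nlinarith
  · obtain ⟨v, rfl⟩ : ∃ v, u = r + v := ⟨u - r, by omega⟩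
    rw [midpoint_comm (p r), h3]
    have h4 := dist_queue_le hn hp hq n T r v (by omega) (by omega)
    rw [dist_comm] at h4
    have := dist_midpoint_midpoint_le_half h4
      (dist_le_diam_window (queue_mem_convexHull hn hp hq (T := T) (s := r + v) (by omega))
        (apex_mem_convexHull hn hp hq hTr))
    nlinarith

-- Index gaps inside a window are at most `n`: `n * n` steps of delay serve the queue estimate, and
-- the extra `n` steps allow the apex to be compared with a midpoint formed after that delay.
include hn hp hq in
theorem diam_window_le (T : ℕ) : Metric.diam (window n p q (T + (n * n + n))) ≤
    (1 - (1 / 2) ^ (n + 1)) * Metric.diam (window n p q T) := by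
  set d := Metric.diam (window n p q T) with hd
  have hd0 : 0 ≤ d := Metric.diam_nonneg
  have hg1 : ((1 : ℝ) / 2) ^ n ≤ 1 := pow_le_one₀ (by norm_num) (by norm_num)
  have hg0 : 0 ≤ ((1 : ℝ) / 2) ^ n := by positivity
  have hnn : 0 ≤ (1 - (1 / 2 : ℝ) ^ (n + 1)) * d :=
    mul_nonneg (sub_nonneg.2 (pow_le_one₀ (by norm_num) (by norm_num))) hd0
  have hqq : ∀ i j, T + (n * n + n) ≤ i → i ≤ j → j < T + (n * n + n) + n →
      dist (q i) (q j) ≤ (1 - (1 / 2) ^ (n + 1)) * d := by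
    intro i j h1 h2 h3
    obtain ⟨m, rfl⟩ : ∃ m, j = i + m := ⟨j - i, by omega⟩
    have := dist_queue_le hn hp hq n T i m (by omega) (by omega)
    rw [pow_succ]
    nlinarith
  have hpq : ∀ j, T + (n * n + n) ≤ j → j < T + (n * n + n) + n →
      dist (p (T + (n * n + n))) (q j) ≤ (1 - (1 / 2) ^ (n + 1)) * d := by
    intro j h1 h2
    obtain ⟨m, rfl⟩ : ∃ m, j = T + (n * n + n) + m := ⟨j - (T + (n * n + n)), by omega⟩
    exact dist_apex_queue_le hn hp hq (by omega) (by omega)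
  refine Metric.diam_le_of_forall_dist_le hnn ?_
  rintro x (rfl | ⟨i, ⟨hi1, hi2⟩, rfl⟩) y (rfl | ⟨j, ⟨hj1, hj2⟩, rfl⟩)
  · simpa using hnn
  · exact hpq j hj1 hj2
  · rw [dist_comm]; exact hpq i hi1 hi2
  · rcases le_total i j with h | h
    · exact hqq i j hi1 h hj2
    · rw [dist_comm]; exact hqq j i hj1 h hi2

include hn hp hq in
/-- The convex hulls of the windows of a bisection process shrink to a point. -/
theorem exists_window_dist_lt {ε : ℝ} (hε : 0 < ε) : ∃ t, ∀ x ∈ convexHull ℝ (window n p q t),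
    ∀ y ∈ convexHull ℝ (window n p q t), dist x y < ε := by
  set ρ : ℝ := 1 - (1 / 2) ^ (n + 1)
  have hρ0 : 0 ≤ ρ := sub_nonneg.2 (pow_le_one₀ (by norm_num) (by norm_num))
  have hρ1 : ρ < 1 := sub_lt_self _ (by positivity)
  have hk : ∀ k, Metric.diam (window n p q (k * (n * n + n))) ≤
      ρ ^ k * Metric.diam (window n p q 0) := by
    intro k
    induction k with
    | zero => simp
    | succ k ih =>
      rw [add_mul, one_mul, pow_succ', mul_assoc]
      exact (diam_window_le hn hp hq _).trans (mul_le_mul_of_nonneg_left ih hρ0)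
  have hlim : Filter.Tendsto (fun k => ρ ^ k * Metric.diam (window n p q 0)) Filter.atTop
      (nhds 0) := by
    simpa using (tendsto_pow_atTop_nhds_zero_of_lt_one hρ0 hρ1).mul_const
      (Metric.diam (window n p q 0))
  obtain ⟨k, hkε⟩ := (hlim.eventually (gt_mem_nhds hε)).exists
  exact ⟨_, fun x hx y hy => ((dist_le_diam_window hx hy).trans (hk k)).trans_lt hkε⟩

end Bisection

/-! ### Barycentric coordinates and affine extensions -/

/-- Barycentric coordinates with respect to the vertices of `Γ`. -/
noncomputable def bary {n : ℕ} (p : Fin n → ℝ) : Fin (n + 1) → ℝ := (V n)⁻¹.mulVec (hom p)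

theorem V_mulVec_bary {n : ℕ} (hn : 1 ≤ n) (p : Fin n → ℝ) : (V n).mulVec (bary p) = hom p :=
  V_inv_mulVec n hn _

theorem sum_bary {n : ℕ} (hn : 1 ≤ n) (p : Fin n → ℝ) : ∑ j, bary p j = 1 := by
  rw [← V_last, V_mulVec_bary hn, hom_last]

theorem bary_injective {n : ℕ} (hn : 1 ≤ n) :
    Function.Injective (bary : (Fin n → ℝ) → Fin (n + 1) → ℝ) := by
  intro p q h
  funext i
  rw [← hom_castSucc p, ← hom_castSucc q, ← V_mulVec_bary hn, ← V_mulVec_bary hn, h]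

/-- The point with barycentric coordinates `x`. -/
def ofBary {n : ℕ} (x : Fin (n + 1) → ℝ) : Fin n → ℝ := fun i => (V n).mulVec x i.castSucc

theorem hom_ofBary {n : ℕ} (x : Fin (n + 1) → ℝ) (hx : ∑ j, x j = 1) :
    hom (ofBary x) = (V n).mulVec x := by
  funext i
  refine Fin.lastCases ?_ (fun i => ?_) i
  · rw [hom_last, V_last, hx]
  · rw [hom_castSucc]; rfl

theorem bary_ofBary {n : ℕ} (hn : 1 ≤ n) (x : Fin (n + 1) → ℝ) (hx : ∑ j, x j = 1) :
    bary (ofBary x) = x := by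
  rw [bary, hom_ofBary x hx, Matrix.mulVec_mulVec, Matrix.nonsing_inv_mul _
    ((Matrix.isUnit_iff_isUnit_det _).1 (V_isUnit n hn)), Matrix.one_mulVec]

theorem ofBary_bary {n : ℕ} (hn : 1 ≤ n) (p : Fin n → ℝ) : ofBary (bary p) = p :=
  bary_injective hn (bary_ofBary hn _ (sum_bary hn p))

theorem ofBary_eq_sum {n : ℕ} (x : Fin (n + 1) → ℝ) : ofBary x = ∑ i, x i • vertex n i := by
  funext j
  simp [ofBary, Matrix.mulVec, dotProduct, vertex, mul_comm]

theorem mem_Gam_iff {n : ℕ} (hn : 1 ≤ n) (p : Fin n → ℝ) : p ∈ Gam n ↔ ∀ j, 0 ≤ bary p j := by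
  refine ⟨bary_nonneg n hn p, fun h => ?_⟩
  have := mem_Gam_of_bary n _ h (sum_bary hn p)
  rwa [show (fun i : Fin n => (V n).mulVec (bary p) i.castSucc) = p from ofBary_bary hn p] at this

theorem mem_GamO_iff {n : ℕ} (hn : 1 ≤ n) (p : Gam n) : p ∈ GamO n ↔ 0 < bary p.1 0 := by
  constructor
  · rintro ⟨x, -, hs, h0, hp⟩
    rwa [hp, ← ofBary_eq_sum, bary_ofBary hn x hs]
  · intro h
    refine ⟨bary p.1, (mem_Gam_iff hn _).1 p.2, sum_bary hn _, h, ?_⟩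
    rw [← ofBary_eq_sum, ofBary_bary hn]

theorem bary_vertex {n : ℕ} (hn : 1 ≤ n) (i : Fin (n + 1)) : bary (vertex n i) = Pi.single i 1 := by
  have : vertex n i = ofBary (Pi.single i 1) := by
    funext j
    simp [ofBary, vertex]
  rw [this, bary_ofBary hn]
  simp

theorem convexHull_vertex {n : ℕ} (hn : 1 ≤ n) :
    Gam n ⊆ convexHull ℝ (Set.range (vertex n)) := by
  intro p hp
  rw [← ofBary_bary hn p, ofBary_eq_sum]
  exact (convex_convexHull ℝ _).sum_mem (fun i _ => (mem_Gam_iff hn p).1 hp i) (sum_bary hn p)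
    fun i _ => subset_convexHull ℝ _ ⟨i, rfl⟩

/-- Linear homogeneous coordinates `(α_1, …, α_n, 0)`. -/
def homLin (n : ℕ) : (Fin n → ℝ) →ₗ[ℝ] (Fin (n + 1) → ℝ) where
  toFun p := Fin.snoc (α := fun _ => ℝ) p 0
  map_add' p q := by
    funext i
    refine Fin.lastCases ?_ (fun i => ?_) i <;> simp
  map_smul' c p := by
    funext i
    refine Fin.lastCases ?_ (fun i => ?_) i <;> simp

theorem hom_add {n : ℕ} (p q : Fin n → ℝ) : hom (p + q) = homLin n p + hom q := by
  funext i
  refine Fin.lastCases ?_ (fun i => ?_) i <;> simp [hom, homLin]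

/-- Barycentric coordinates as an affine map. -/
noncomputable def baryAff (n : ℕ) : (Fin n → ℝ) →ᵃ[ℝ] (Fin (n + 1) → ℝ) where
  toFun := bary
  linear := (V n)⁻¹.mulVecLin ∘ₗ homLin n
  map_vadd' p v := by
    simp [bary, hom_add, Matrix.mulVec_add]

theorem baryAff_apply {n : ℕ} (p : Fin n → ℝ) : baryAff n p = bary p := rfl

theorem continuous_bary (n : ℕ) : Continuous (bary : (Fin n → ℝ) → Fin (n + 1) → ℝ) :=
  (baryAff n).continuous_of_finiteDimensional

/-- The affine map of `ℝⁿ` given in barycentric coordinates by a linear map. -/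
noncomputable def affOf {n : ℕ} (f : (Fin (n + 1) → ℝ) →ₗ[ℝ] (Fin (n + 1) → ℝ)) :
    (Fin n → ℝ) →ᵃ[ℝ] (Fin n → ℝ) :=
  (LinearMap.funLeft ℝ ℝ Fin.castSucc ∘ₗ (V n).mulVecLin ∘ₗ f).toAffineMap.comp (baryAff n)

theorem affOf_apply {n : ℕ} (f : (Fin (n + 1) → ℝ) →ₗ[ℝ] (Fin (n + 1) → ℝ)) (p : Fin n → ℝ) :
    affOf f p = ofBary (f (bary p)) := rfl

theorem bary_affOf {n : ℕ} (hn : 1 ≤ n) {f : (Fin (n + 1) → ℝ) →ₗ[ℝ] (Fin (n + 1) → ℝ)}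
    (hf : ∀ x, ∑ i, f x i = ∑ i, x i) (p : Fin n → ℝ) : bary (affOf f p) = f (bary p) := by
  rw [affOf_apply, bary_ofBary hn _ ((hf _).trans (sum_bary hn p))]

/-! ### The action of `B n a` on barycentric coordinates -/

theorem sum_B_mulVec {n : ℕ} (hn : 1 ≤ n) (a : Fin 2) (x : Fin (n + 1) → ℝ) :
    ∑ i, (B n a).mulVecLin x i = ∑ i, x i := by
  simp only [Matrix.mulVecLin_apply, Matrix.mulVec, dotProduct]
  rw [Finset.sum_comm]
  simp only [← Finset.sum_mul, B_colsum n hn a, one_mul]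

theorem B_mulVec_zero {n : ℕ} (hn : 1 ≤ n) (x : Fin (n + 1) → ℝ) (a : Fin 2) :
    (B n a).mulVec x 0 = (if a = 0 then x 0 else 0) + x (Fin.last n) / 2 := by
  have h0 : (0 : Fin (n + 1)) ≠ Fin.last n := by
    intro h; have := congrArg Fin.val h; simp at this; omega
  rw [Matrix.mulVec, dotProduct, Finset.sum_eq_add 0 (Fin.last n) h0]
  · fin_cases a <;> simp [B, A, show (0 : ℕ) ≠ n by omega] <;> ring
  · rintro k - ⟨hk0, hkn⟩
    have h1 : k.val ≠ 0 := fun h => hk0 (Fin.ext h)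
    have h2 : k.val ≠ n := fun h => hkn (Fin.ext h)
    simp [B, A, h1, h2]
  · simp
  · simp

theorem B_mulVec_one {n : ℕ} (hn : 1 ≤ n) (x : Fin (n + 1) → ℝ) (a : Fin 2) :
    (B n a).mulVec x ⟨1, by omega⟩ = (if a = 1 then x 0 else 0) + x (Fin.last n) / 2 := by
  have h0 : (0 : Fin (n + 1)) ≠ Fin.last n := by
    intro h; have := congrArg Fin.val h; simp at this; omega
  rw [Matrix.mulVec, dotProduct, Finset.sum_eq_add 0 (Fin.last n) h0]
  · fin_cases a <;> simp [B, A, show (0 : ℕ) ≠ n by omega] <;> ring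
  · rintro k - ⟨hk0, hkn⟩
    have h1 : k.val ≠ 0 := fun h => hk0 (Fin.ext h)
    have h2 : k.val ≠ n := fun h => hkn (Fin.ext h)
    simp [B, A, h1, h2]
  · simp
  · simp

theorem B_mulVec_succ {n : ℕ} (x : Fin (n + 1) → ℝ) (a : Fin 2) (j : ℕ) (h1 : 1 ≤ j)
    (hj : j < n) : (B n a).mulVec x ⟨j + 1, by omega⟩ = x ⟨j, by omega⟩ := by
  have ha := a.isLt
  rw [Matrix.mulVec, dotProduct, Finset.sum_eq_single ⟨j, by omega⟩]
  · simp [B, A, h1, show j ≠ n by omega]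
  · rintro k - hk
    have h2 : k.val ≠ j := fun h => hk (Fin.ext h)
    have h3 : B n a ⟨j + 1, by omega⟩ k = 0 := by
      simp only [B, A]
      have h4 : ¬(k.val = 0 ∧ j + 1 = a.val ∨ k.val = n ∧ (j + 1 = 0 ∨ j + 1 = 1) ∨
          1 ≤ k.val ∧ j + 1 = k.val + 1) := by omega
      rw [if_neg h4, zero_div, ite_self]
    rw [h3, zero_mul]
  · simp

theorem B_mulVec_injective {n : ℕ} (hn : 1 ≤ n) (a : Fin 2) :
    Function.Injective (B n a).mulVec := by
  intro x y h
  have h0 := congrFun h 0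
  have h1 := congrFun h ⟨1, by omega⟩
  rw [B_mulVec_zero hn, B_mulVec_zero hn] at h0
  rw [B_mulVec_one hn, B_mulVec_one hn] at h1
  have hl : x (Fin.last n) = y (Fin.last n) ∧ x 0 = y 0 := by
    fin_cases a <;> simp at h0 h1 <;> constructor <;> linarith
  funext i
  rcases Nat.eq_zero_or_pos i.val with hi | hi
  · rw [show i = 0 from Fin.ext hi]; exact hl.2
  · rcases Nat.lt_or_ge i.val n with hlt | hge
    · have := congrFun h ⟨i.val + 1, by omega⟩
      rwa [B_mulVec_succ x a i.val hi hlt, B_mulVec_succ y a i.val hi hlt] at this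
    · rw [show i = Fin.last n from Fin.ext (by have := i.isLt; simp; omega)]; exact hl.1

/-- The affine extension of `τ_a`. -/
noncomputable def tauAff (n : ℕ) (a : Fin 2) : (Fin n → ℝ) →ᵃ[ℝ] (Fin n → ℝ) :=
  affOf (B n a).mulVecLin

theorem coe_tau (n : ℕ) (a : Fin 2) (p : Gam n) : (tau n a p : Fin n → ℝ) = tauAff n a p := by
  funext i
  simp only [tau, tauAff, affOf_apply, D, bary, ofBary, Matrix.mulVecLin_apply,
    Matrix.mulVec_mulVec, Matrix.mul_assoc]

theorem bary_tauAff {n : ℕ} (hn : 1 ≤ n) (a : Fin 2) (p : Fin n → ℝ) :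
    bary (tauAff n a p) = (B n a).mulVec (bary p) :=
  bary_affOf hn (sum_B_mulVec hn a) p

theorem bary_tau {n : ℕ} (hn : 1 ≤ n) (a : Fin 2) (p : Gam n) :
    bary (tau n a p).1 = (B n a).mulVec (bary p.1) := by
  rw [coe_tau, bary_tauAff hn]

theorem tauAff_injective {n : ℕ} (hn : 1 ≤ n) (a : Fin 2) : Function.Injective (tauAff n a) := by
  intro p q h
  have := congrArg bary h
  rw [bary_tauAff hn, bary_tauAff hn] at this
  exact bary_injective hn (B_mulVec_injective hn a this)

theorem tau_injective {n : ℕ} (hn : 1 ≤ n) (a : Fin 2) : Function.Injective (tau n a) := by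
  intro p q h
  have := congrArg Subtype.val h
  rw [coe_tau, coe_tau] at this
  exact Subtype.ext (tauAff_injective hn a this)

theorem continuous_tau (n : ℕ) (a : Fin 2) : Continuous (tau n a) := by
  refine continuous_induced_rng.2 ?_
  have : Subtype.val ∘ tau n a = tauAff n a ∘ Subtype.val := funext (coe_tau n a)
  rw [this]
  exact (tauAff n a).continuous_of_finiteDimensional.comp continuous_subtype_val

theorem tauAff_bijective {n : ℕ} (hn : 1 ≤ n) (a : Fin 2) : Function.Bijective (tauAff n a) := by
  refine ⟨tauAff_injective hn a, ?_⟩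
  rw [← AffineMap.linear_surjective_iff, ← LinearMap.injective_iff_surjective,
    AffineMap.linear_injective_iff]
  exact tauAff_injective hn a

/-- The affine extension of `τ_a` as an automorphism of `ℝⁿ`. -/
noncomputable def tauEquiv {n : ℕ} (hn : 1 ≤ n) (a : Fin 2) : (Fin n → ℝ) ≃ᵃ[ℝ] (Fin n → ℝ) :=
  AffineEquiv.ofBijective (tauAff_bijective hn a)

theorem coe_tau_eq_tauEquiv {n : ℕ} (hn : 1 ≤ n) (a : Fin 2) (p : Gam n) :
    (tau n a p : Fin n → ℝ) = tauEquiv hn a p := coe_tau n a p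

/-! ### Comparison of the determinants of the two maps -/

/-- The affine involution exchanging the vertices `v_0` and `v_1`. -/
noncomputable def reflAff {n : ℕ} (hn : 1 ≤ n) : (Fin n → ℝ) →ᵃ[ℝ] (Fin n → ℝ) :=
  affOf (LinearMap.funLeft ℝ ℝ (Equiv.swap (0 : Fin (n + 1)) ⟨1, by omega⟩))

theorem bary_reflAff {n : ℕ} (hn : 1 ≤ n) (p : Fin n → ℝ) (i : Fin (n + 1)) :
    bary (reflAff hn p) i = bary p (Equiv.swap (0 : Fin (n + 1)) ⟨1, by omega⟩ i) := by
  rw [reflAff, bary_affOf hn, LinearMap.funLeft_apply]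
  intro x
  exact Equiv.sum_comp (Equiv.swap (0 : Fin (n + 1)) ⟨1, by omega⟩) x

theorem reflAff_comp_self {n : ℕ} (hn : 1 ≤ n) :
    (reflAff hn).comp (reflAff hn) = AffineMap.id ℝ _ := by
  ext1 p
  refine bary_injective hn (funext fun i => ?_)
  simp [bary_reflAff]

/-- Changing `a` only changes which of the coordinates 0 and 1 receives the old coordinate 0; the
half-shares of the last coordinate are symmetric. -/
theorem reflAff_comp_tauAff {n : ℕ} (hn : 1 ≤ n) :
    (reflAff hn).comp (tauAff n 0) = tauAff n 1 := by
  ext1 p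
  refine bary_injective hn (funext fun i => ?_)
  rw [AffineMap.comp_apply, bary_reflAff, bary_tauAff hn, bary_tauAff hn]
  rcases Nat.eq_zero_or_pos i.val with hi | hi
  · rw [show i = 0 from Fin.ext hi, Equiv.swap_apply_left, B_mulVec_one hn, B_mulVec_zero hn]
    simp
  · rcases Nat.lt_or_ge 1 i.val with h1 | h1
    · rw [Equiv.swap_apply_of_ne_of_ne (by rintro rfl; simp at hi) (by rintro rfl; simp at h1)]
      obtain ⟨j, hj⟩ : ∃ j, i.val = j + 1 := ⟨i.val - 1, by omega⟩
      rw [show i = ⟨j + 1, by omega⟩ from Fin.ext hj]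
      rw [B_mulVec_succ _ _ j (by omega) (by omega), B_mulVec_succ _ _ j (by omega) (by omega)]
    · rw [show i = ⟨1, by omega⟩ from Fin.ext (by simp; omega)]
      rw [Equiv.swap_apply_right, B_mulVec_one hn, B_mulVec_zero hn]
      simp

theorem coe_det_tauEquiv {n : ℕ} (hn : 1 ≤ n) (a : Fin 2) :
    (LinearEquiv.det (tauEquiv hn a).linear : ℝ) = LinearMap.det (tauAff n a).linear := by
  rw [LinearEquiv.coe_det]; rfl

/-- The factor `r` is the determinant of an involution. Working with units allows the determinants
of powers and inverses to be cancelled later. -/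
theorem exists_det_tauEquiv {n : ℕ} (hn : 1 ≤ n) : ∃ r : ℝˣ, (r = 1 ∨ r = -1) ∧
    LinearEquiv.det (tauEquiv hn 1).linear = r * LinearEquiv.det (tauEquiv hn 0).linear := by
  have h1 : LinearMap.det (reflAff hn).linear * LinearMap.det (reflAff hn).linear = 1 := by
    have := congrArg (fun f => LinearMap.det f.linear) (reflAff_comp_self hn)
    simpa using this
  have h2 : LinearMap.det (tauAff n 1).linear =
      LinearMap.det (reflAff hn).linear * LinearMap.det (tauAff n 0).linear := by
    rw [← reflAff_comp_tauAff hn]; simp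
  rcases mul_self_eq_one_iff.1 h1 with h | h
  · exact ⟨1, Or.inl rfl, Units.ext (by
      rw [Units.val_mul, coe_det_tauEquiv, coe_det_tauEquiv, h2, h]; simp)⟩
  · exact ⟨-1, Or.inr rfl, Units.ext (by
      rw [Units.val_mul, coe_det_tauEquiv, coe_det_tauEquiv, h2, h]; simp)⟩

theorem abs_det_tauAff {n : ℕ} (hn : 1 ≤ n) (a : Fin 2) :
    |LinearMap.det (tauAff n a).linear| = |LinearMap.det (tauAff n 0).linear| := by
  obtain ⟨r, hr, h⟩ := exists_det_tauEquiv hn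
  have h' : LinearMap.det (tauAff n 1).linear = r * LinearMap.det (tauAff n 0).linear := by
    rw [← coe_det_tauEquiv hn, ← coe_det_tauEquiv hn, h, Units.val_mul]
  fin_cases a
  · rfl
  · rcases hr with rfl | rfl <;> simpa using congrArg abs h'

/-! ### Images of the vertices -/

theorem vertex_zero {n : ℕ} : vertex n 0 = (v0 n).1 := rfl

theorem tauAff_vertex_succ {n : ℕ} (hn : 1 ≤ n) (a : Fin 2) {j : ℕ} (h1 : 1 ≤ j) (hj : j < n) :
    tauAff n a (vertex n ⟨j, by omega⟩) = vertex n ⟨j + 1, by omega⟩ := by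
  refine bary_injective hn ?_
  rw [bary_tauAff hn, bary_vertex hn, bary_vertex hn]
  funext i
  have ha := a.isLt
  simp only [Matrix.mulVec_single_one, Matrix.col_apply, B, A, Pi.single_apply, Fin.ext_iff]
  rw [if_neg (by omega)]
  by_cases h : i.val = j + 1
  · rw [if_pos (by omega), if_pos h]
  · rw [if_neg (by omega), if_neg h]

theorem tauAff_vertex_zero {n : ℕ} (hn : 1 ≤ n) (a : Fin 2) :
    tauAff n a (vertex n 0) = vertex n ⟨a.val, by omega⟩ := by
  refine bary_injective hn ?_
  rw [bary_tauAff hn, bary_vertex hn, bary_vertex hn]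
  funext i
  simp only [Matrix.mulVec_single_one, Matrix.col_apply, B, A, Pi.single_apply, Fin.ext_iff,
    Fin.val_zero]
  rw [if_neg (by omega)]
  have h0 : 0 ≠ n := by omega
  simp [h0]

theorem bary_midpoint {n : ℕ} (p q : Fin n → ℝ) :
    bary (midpoint ℝ p q) = midpoint ℝ (bary p) (bary q) :=
  (baryAff n).map_midpoint p q

theorem tauAff_vertex_last {n : ℕ} (hn : 1 ≤ n) (a : Fin 2) :
    tauAff n a (vertex n (Fin.last n)) = midpoint ℝ (vertex n 0) (vertex n ⟨1, by omega⟩) := by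
  refine bary_injective hn ?_
  rw [bary_tauAff hn, bary_midpoint, bary_vertex hn, bary_vertex hn, bary_vertex hn]
  funext i
  have ha := a.isLt
  simp only [Matrix.mulVec_single_one, Matrix.col_apply, B, A, midpoint_eq_smul_add,
    Pi.smul_apply, Pi.add_apply, Pi.single_apply, Fin.ext_iff, Fin.val_zero, Fin.val_last, if_true,
    smul_eq_mul]
  have h0 : n ≠ 0 := by omega
  have h1 : i.val ≠ n + 1 := by have := i.isLt; omega
  by_cases h : i.val = 0
  · simp [h]
  · simp [h, h0, h1, div_eq_inv_mul]

/-! ### Binary digits of `2`-adic integers -/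

theorem eq_appr_of_sub_mem (a : ℤ_[2]) (m x : ℕ) (hx : x < 2 ^ m)
    (h : a - x ∈ Ideal.span {(2 : ℤ_[2]) ^ m}) : a.appr m = x := by
  have h1 := PadicInt.appr_spec m a
  have h2 : ((a.appr m : ℕ) : ℤ_[2]) - x ∈ Ideal.span {((2 : ℕ) : ℤ_[2]) ^ m} := by
    have := sub_mem h h1
    simpa using this
  rw [← PadicInt.ker_toZModPow, RingHom.mem_ker, map_sub, map_natCast, map_natCast, sub_eq_zero,
    ZMod.natCast_eq_natCast_iff] at h2
  exact Nat.ModEq.eq_of_lt_of_lt h2 (PadicInt.appr_lt a m) hx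

theorem appr_add_two_mul (e : Fin 2) (b : ℤ_[2]) (m : ℕ) :
    ((e.val : ℤ_[2]) + 2 * b).appr (m + 1) = e.val + 2 * b.appr m := by
  refine eq_appr_of_sub_mem _ _ _ ?_ ?_
  · have := PadicInt.appr_lt b m
    have := e.isLt
    rw [pow_succ]
    omega
  · obtain ⟨c, hc⟩ := Ideal.mem_span_singleton.1 (PadicInt.appr_spec m b)
    refine Ideal.mem_span_singleton.2 ⟨c, ?_⟩
    push_cast at hc ⊢
    linear_combination 2 * hc

theorem digit_add_two_mul_zero (e : Fin 2) (b : ℤ_[2]) :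
    digit ((e.val : ℤ_[2]) + 2 * b) 0 = e := by
  have := e.isLt
  refine Fin.ext ?_
  simp only [digit]
  rw [appr_add_two_mul]
  simp only [PadicInt.appr]
  omega

theorem digit_add_two_mul_succ (e : Fin 2) (b : ℤ_[2]) (t : ℕ) :
    digit ((e.val : ℤ_[2]) + 2 * b) (t + 1) = digit b t := by
  have := e.isLt
  refine Fin.ext ?_
  simp only [digit, appr_add_two_mul _ _ (t + 1)]
  rw [pow_succ', ← Nat.div_div_eq_div_mul]
  congr 2
  omega

theorem exists_eq_add_two_mul (a : ℤ_[2]) :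
    ∃ (e : Fin 2) (b : ℤ_[2]), a = (e.val : ℤ_[2]) + 2 * b := by
  obtain ⟨b, hb⟩ := Ideal.mem_span_singleton.1 (PadicInt.appr_spec 1 a)
  exact ⟨⟨a.appr 1, by simpa using PadicInt.appr_lt a 1⟩, b, by
    push_cast at hb; linear_combination hb⟩

theorem two_mul_padic_ne_one (b : ℤ_[2]) : 2 * b ≠ 1 := by
  intro h
  have h2 : IsUnit (2 : ℤ_[2]) := IsUnit.of_mul_eq_one _ h
  exact (PadicInt.prime_p (p := 2)).not_isUnit (by exact_mod_cast h2)

/-- Stripping the lowest digit of both numbers divides their difference by 2; if the lowest digits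
differed, divisibility by 2 would make 2 a unit. -/
theorem digits_eq_iff_dvd (t : ℕ) : ∀ a b : ℤ_[2],
    (∀ s < t, digit a s = digit b s) ↔ (2 : ℤ_[2]) ^ t ∣ a - b := by
  induction t with
  | zero => simp
  | succ t ih =>
    intro a b
    obtain ⟨e, a, rfl⟩ := exists_eq_add_two_mul a
    obtain ⟨f, b, rfl⟩ := exists_eq_add_two_mul b
    constructor
    · intro h
      have h0 := h 0 (by omega)
      rw [digit_add_two_mul_zero, digit_add_two_mul_zero] at h0
      subst h0
      obtain ⟨c, hc⟩ := (ih a b).1 fun s hs => by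
        simpa only [digit_add_two_mul_succ] using h (s + 1) (by omega)
      exact ⟨c, by rw [pow_succ]; linear_combination 2 * hc⟩
    · rintro ⟨c, hc⟩
      obtain rfl : e = f := by
        fin_cases e <;> fin_cases f <;> first | rfl | exfalso
        · exact two_mul_padic_ne_one (a - b - 2 ^ t * c) (by
            push_cast [pow_succ] at hc; linear_combination hc)
        · exact two_mul_padic_ne_one (b - a + 2 ^ t * c) (by
            push_cast [pow_succ] at hc; linear_combination -hc)
      have h1 := (ih a b).2 ⟨c, mul_left_cancel₀ two_ne_zero (by
        rw [pow_succ] at hc; linear_combination hc)⟩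
      rintro (_ | s) hs
      · rw [digit_add_two_mul_zero, digit_add_two_mul_zero]
      · rw [digit_add_two_mul_succ, digit_add_two_mul_succ, h1 s (by omega)]

theorem digits_eq_iff_dist_le (t : ℕ) (a b : ℤ_[2]) :
    (∀ s < t, digit a s = digit b s) ↔ dist a b ≤ (1 / 2) ^ t := by
  rw [digits_eq_iff_dvd, dist_eq_norm, ← Ideal.mem_span_singleton]
  have := PadicInt.norm_le_pow_iff_mem_span_pow (p := 2) (a - b) t
  rw [zpow_neg, zpow_natCast, ← inv_pow] at this
  simpa using this.symm

theorem digit_injective : Function.Injective digit := by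
  intro a b h
  refine dist_le_zero.1 (ge_of_tendsto' (tendsto_pow_atTop_nhds_zero_of_lt_one (r := (1 / 2 : ℝ))
    (by norm_num) (by norm_num)) fun t => ?_)
  exact (digits_eq_iff_dist_le t a b).1 fun s _ => congrFun h s

/-- The series $\sum s_i2^i$ converges geometrically. Splitting off its first term leaves twice the
series of the shifted sequence, so induction recovers every digit. -/
theorem exists_digit_eq (s : ℕ → Fin 2) : ∃ a : ℤ_[2], digit a = s := by
  have hs : ∀ s : ℕ → Fin 2, Summable fun i => ((s i).val : ℤ_[2]) * 2 ^ i := by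
    intro s
    refine Summable.of_norm_bounded (summable_geometric_of_lt_one (r := (1 / 2 : ℝ))
      (by norm_num) (by norm_num)) fun i => ?_
    have h2 : ‖(2 : ℤ_[2])‖ = 1 / 2 := by simpa using PadicInt.norm_p (p := 2)
    rw [norm_mul, norm_pow, h2]
    exact mul_le_of_le_one_left (by positivity) (PadicInt.norm_le_one _)
  have hstep : ∀ s : ℕ → Fin 2, ∑' i, ((s i).val : ℤ_[2]) * 2 ^ i =
      (s 0).val + 2 * ∑' i, ((s (i + 1)).val : ℤ_[2]) * 2 ^ i := by
    intro s
    rw [(hs s).tsum_eq_zero_add, ← (hs fun i => s (i + 1)).tsum_mul_left]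
    simp only [pow_succ', mul_left_comm _ (2 : ℤ_[2]), pow_zero, mul_one]
  have key : ∀ (t : ℕ) (s : ℕ → Fin 2), digit (∑' i, ((s i).val : ℤ_[2]) * 2 ^ i) t = s t := by
    intro t
    induction t with
    | zero =>
      intro s
      rw [hstep, digit_add_two_mul_zero]
    | succ t ih =>
      intro s
      rw [hstep, digit_add_two_mul_succ, ih fun i => s (i + 1)]
  exact ⟨_, funext fun t => key t s⟩

/-! ### Shrinking cells and the coding map -/

/-- The affine extension of `τ_{a_0} ⋯ τ_{a_{t-1}}`. -/
noncomputable def wordAff (n : ℕ) (a : ℕ → Fin 2) : ℕ → (Fin n → ℝ) →ᵃ[ℝ] (Fin n → ℝ)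
  | 0 => AffineMap.id ℝ _
  | t + 1 => (wordAff n a t).comp (tauAff n (a t))

theorem coe_tauWord (n : ℕ) (a : ℕ → Fin 2) (t : ℕ) (p : Gam n) :
    (tauWord n a t p : Fin n → ℝ) = wordAff n a t p := by
  induction t generalizing p with
  | zero => rfl
  | succ t ih => simp [tauWord, wordAff, ih, coe_tau]

/-- The recursive definition adds the innermost letter; self-similarity of cells requires removing
the outermost one. -/
theorem tauWord_succ' (n : ℕ) (a : ℕ → Fin 2) (t : ℕ) :
    tauWord n a (t + 1) = tau n (a 0) ∘ tauWord n (fun s => a (s + 1)) t := by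
  induction t with
  | zero => rfl
  | succ t ih => rw [tauWord, ih]; rfl

theorem tauWord_congr {n : ℕ} {a b : ℕ → Fin 2} {t : ℕ} (h : ∀ s < t, a s = b s) :
    tauWord n a t = tauWord n b t := by
  induction t with
  | zero => rfl
  | succ t ih => rw [tauWord, tauWord, ih fun s hs => h s (by omega), h t (by omega)]

theorem continuous_tauWord (n : ℕ) (a : ℕ → Fin 2) (t : ℕ) : Continuous (tauWord n a t) := by
  induction t with
  | zero => exact continuous_id
  | succ t ih => exact ih.comp (continuous_tau n _)

theorem cell_antitone (n : ℕ) (a : ℕ → Fin 2) : Antitone (cell n a) :=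
  antitone_nat_of_succ_le fun _ => Set.range_comp_subset_range _ _

theorem isCompact_Gam (n : ℕ) : IsCompact (Gam n) := by
  refine (isCompact_univ_pi fun _ : Fin n =>
    isCompact_Icc (a := (0 : ℝ)) (b := 1)).of_isClosed_subset ?_ fun p hp i _ => hp.1 i
  have : Gam n = (⋂ i, {p | 0 ≤ p i ∧ p i ≤ 1}) ∩ ⋂ (i) (j) (_ : i ≤ j), {p | p j ≤ p i} := by
    ext p
    simp [Gam, Antitone]
  rw [this]
  refine (isClosed_iInter fun i => ?_).inter
    (isClosed_iInter fun i => isClosed_iInter fun j => isClosed_iInter fun _ => ?_)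
  · exact (isClosed_le continuous_const (continuous_apply i)).inter
      (isClosed_le (continuous_apply i) continuous_const)
  · exact isClosed_le (continuous_apply j) (continuous_apply i)

instance (n : ℕ) : CompactSpace (Gam n) := isCompact_iff_compactSpace.1 (isCompact_Gam n)

theorem isCompact_cell (n : ℕ) (a : ℕ → Fin 2) (t : ℕ) : IsCompact (cell n a t) :=
  isCompact_range (continuous_tauWord n a t)

/-- Each further letter, whatever its value, merely moves the vertex one place up. Hence all
vertices of a cell except the apex belong to a single sequence, the queue. -/
theorem wordAff_vertex {n : ℕ} (hn : 1 ≤ n) (a : ℕ → Fin 2) (t j : ℕ) (hj : j < n) :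
    wordAff n a (t + j) (vertex n ⟨1, by omega⟩) = wordAff n a t (vertex n ⟨j + 1, by omega⟩) := by
  induction j generalizing t with
  | zero => rfl
  | succ j ih =>
    rw [show t + (j + 1) = t + 1 + j by ring, ih (t + 1) (by omega), wordAff, AffineMap.comp_apply,
      tauAff_vertex_succ hn _ (by omega) (by omega)]

theorem exists_cell_dist_lt {n : ℕ} (hn : 1 ≤ n) (a : ℕ → Fin 2) {ε : ℝ} (hε : 0 < ε) :
    ∃ t, ∀ p ∈ cell n a t, ∀ q ∈ cell n a t, dist p q < ε := by
  set P : ℕ → Fin n → ℝ := fun t => wordAff n a t (vertex n 0) with hP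
  set Q : ℕ → Fin n → ℝ := fun t => wordAff n a t (vertex n ⟨1, by omega⟩) with hQ
  have hp : ∀ t, P (t + 1) = P t ∨ P (t + 1) = Q t := by
    intro t
    simp only [hP, hQ, wordAff, AffineMap.comp_apply, tauAff_vertex_zero hn]
    generalize a t = b
    fin_cases b
    · exact Or.inl rfl
    · exact Or.inr rfl
  have hq : ∀ t, Q (t + n) = midpoint ℝ (P t) (Q t) := by
    intro t
    obtain ⟨m, rfl⟩ : ∃ m, n = m + 1 := ⟨n - 1, by omega⟩
    simp only [hP, hQ]
    rw [← AffineMap.map_midpoint, ← tauAff_vertex_last hn (a t), ← AffineMap.comp_apply,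
      show t + (m + 1) = t + 1 + m by ring, wordAff_vertex hn a (t + 1) m (by omega)]
    rfl
  have hsub : ∀ t, ∀ p ∈ cell n a t, p.1 ∈ convexHull ℝ (window n P Q t) := by
    rintro t _ ⟨q, rfl⟩
    rw [coe_tauWord]
    have h := Set.mem_image_of_mem (wordAff n a t) (convexHull_vertex hn q.2)
    rw [AffineMap.image_convexHull, ← Set.range_comp] at h
    refine convexHull_mono ?_ h
    rintro _ ⟨i, rfl⟩
    rcases Nat.eq_zero_or_pos i.val with hi | hi
    · rw [show i = 0 from Fin.ext hi]
      exact Set.mem_insert _ _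
    · have hlt := i.isLt
      refine Set.mem_insert_of_mem _ ⟨t + (i.val - 1), ⟨by omega, by omega⟩, ?_⟩
      simp only [hQ, Function.comp]
      rw [wordAff_vertex hn a t (i.val - 1) (by omega)]
      congr 2
      exact Fin.ext (by simp; omega)
  obtain ⟨t, ht⟩ := exists_window_dist_lt hn hp hq hε
  exact ⟨t, fun p h1 q h2 => ht _ (hsub t p h1) _ (hsub t q h2)⟩

theorem eq_of_mem_iInter_cell {n : ℕ} (hn : 1 ≤ n) (a : ℕ → Fin 2) {p q : Gam n}
    (hp : ∀ t, p ∈ cell n a t) (hq : ∀ t, q ∈ cell n a t) : p = q := by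
  refine eq_of_forall_dist_le fun ε hε => ?_
  obtain ⟨t, ht⟩ := exists_cell_dist_lt hn a hε
  exact (ht p (hp t) q (hq t)).le

theorem iInter_cell_eq {n : ℕ} (hn : 1 ≤ n) (a : ℤ_[2]) :
    ⋂ t, cell n (digit a) t = {upsilon n a} := by
  have hne : (⋂ t, cell n (digit a) t).Nonempty :=
    IsCompact.nonempty_iInter_of_sequence_nonempty_isCompact_isClosed _
      (fun t => cell_antitone n _ (Nat.le_succ t)) (fun t => ⟨_, v0 n, rfl⟩)
      (isCompact_cell n _ 0) fun t => (isCompact_cell n _ t).isClosed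
  have hmem : upsilon n a ∈ ⋂ t, cell n (digit a) t := Classical.epsilon_spec hne
  refine Set.eq_singleton_iff_unique_mem.2 ⟨hmem, fun p hp => ?_⟩
  exact eq_of_mem_iInter_cell hn _ (Set.mem_iInter.1 hp) (Set.mem_iInter.1 hmem)

theorem upsilon_mem_cell {n : ℕ} (hn : 1 ≤ n) (a : ℤ_[2]) (t : ℕ) :
    upsilon n a ∈ cell n (digit a) t :=
  Set.mem_iInter.1 ((iInter_cell_eq hn a).symm ▸ Set.mem_singleton _) t

theorem eq_upsilon {n : ℕ} (hn : 1 ≤ n) (a : ℤ_[2]) {p : Gam n}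
    (hp : ∀ t, p ∈ cell n (digit a) t) : p = upsilon n a :=
  eq_of_mem_iInter_cell hn _ hp (upsilon_mem_cell hn a)

theorem cell_digit_succ (n : ℕ) (e : Fin 2) (b : ℤ_[2]) (t : ℕ) :
    cell n (digit ((e.val : ℤ_[2]) + 2 * b)) (t + 1) = tau n e '' cell n (digit b) t := by
  rw [cell, tauWord_succ', Set.range_comp, digit_add_two_mul_zero]
  simp only [digit_add_two_mul_succ]
  rfl

theorem mem_cell_digit {n : ℕ} {e : Fin 2} {b : ℤ_[2]} {p : Gam n}
    (h : ∀ t, p ∈ tau n e '' cell n (digit b) t) (t : ℕ) :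
    p ∈ cell n (digit ((e.val : ℤ_[2]) + 2 * b)) t := by
  cases t with
  | zero => exact ⟨p, rfl⟩
  | succ t => rw [cell_digit_succ]; exact h t

/-- The cells of `e + 2b` at depth `t + 1` are the `tau n e`-images of those of `b` at depth `t`, so
the image point lies in all of them. -/
theorem upsilon_add_two_mul {n : ℕ} (hn : 1 ≤ n) (e : Fin 2) (b : ℤ_[2]) :
    upsilon n ((e.val : ℤ_[2]) + 2 * b) = tau n e (upsilon n b) :=
  (eq_upsilon hn _ (mem_cell_digit fun t => ⟨_, upsilon_mem_cell hn b t, rfl⟩)).symm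

theorem upsilon_two_mul_add_one {n : ℕ} (hn : 1 ≤ n) (b : ℤ_[2]) :
    upsilon n (2 * b + 1) = tau n 1 (upsilon n b) := by
  rw [← upsilon_add_two_mul hn, add_comm]; simp

/-- Nearby 2-adic integers share their first digits, and therefore their images share a small cell.
-/
theorem continuous_upsilon {n : ℕ} (hn : 1 ≤ n) : Continuous (upsilon n) := by
  refine Metric.continuous_iff.2 fun a ε hε => ?_
  obtain ⟨t, ht⟩ := exists_cell_dist_lt hn (digit a) hε
  refine ⟨(1 / 2) ^ t, by positivity, fun b hb => ht _ ?_ _ (upsilon_mem_cell hn a t)⟩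
  have h := upsilon_mem_cell hn b t
  rwa [cell, tauWord_congr ((digits_eq_iff_dist_le t b a).2 hb.le)] at h

/-! ### The two halves of `Γ` -/

theorem bary_tau_zero_sub {n : ℕ} (hn : 1 ≤ n) (q : Fin n → ℝ) :
    bary (tauAff n 0 q) 0 - bary (tauAff n 0 q) ⟨1, by omega⟩ = bary q 0 := by
  rw [bary_tauAff hn, B_mulVec_zero hn, B_mulVec_one hn]; simp

theorem bary_tau_one_sub {n : ℕ} (hn : 1 ≤ n) (q : Fin n → ℝ) :
    bary (tauAff n 1 q) ⟨1, by omega⟩ - bary (tauAff n 1 q) 0 = bary q 0 := by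
  rw [bary_tauAff hn, B_mulVec_zero hn, B_mulVec_one hn]; simp

/-- Only coordinate 0 of the affine preimage can be negative: the intermediate coordinates occur
unchanged in `p`, and half of the last one is coordinate 1 or 0 of `p`, according to `a`. -/
theorem exists_tau_eq {n : ℕ} (hn : 1 ≤ n) (a : Fin 2) (p : Gam n)
    (h : ∀ q, tauAff n a q = p.1 → 0 ≤ bary q 0) : ∃ q : Gam n, tau n a q = p := by
  obtain ⟨q, hq⟩ := (tauAff_bijective hn a).2 p.1
  suffices hG : q ∈ Gam n from ⟨⟨q, hG⟩, Subtype.ext (by rw [coe_tau, hq])⟩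
  have hx := (mem_Gam_iff hn _).1 p.2
  simp only [← hq, bary_tauAff hn] at hx
  refine (mem_Gam_iff hn q).2 fun j => ?_
  rcases Nat.eq_zero_or_pos j.val with hj | hj
  · rw [show j = 0 from Fin.ext hj]; exact h q hq
  · rcases Nat.lt_or_ge j.val n with hlt | hge
    · have := hx ⟨j.val + 1, by omega⟩
      rwa [B_mulVec_succ _ _ j.val hj hlt] at this
    · rw [show j = Fin.last n from Fin.ext (by have := j.isLt; simp; omega)]
      have h0 := hx 0
      have h1 := hx ⟨1, by omega⟩
      rw [B_mulVec_zero hn] at h0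
      rw [B_mulVec_one hn] at h1
      fin_cases a <;> simp at h0 h1 <;> linarith

theorem mem_range_tau_zero_iff {n : ℕ} (hn : 1 ≤ n) (p : Gam n) :
    p ∈ Set.range (tau n 0) ↔ bary p.1 ⟨1, by omega⟩ ≤ bary p.1 0 := by
  constructor
  · rintro ⟨q, rfl⟩
    have := bary_tau_zero_sub hn q.1
    have := (mem_Gam_iff hn _).1 q.2 0
    rw [coe_tau]; linarith
  · intro h
    refine exists_tau_eq hn 0 p fun q hq => ?_
    rw [← bary_tau_zero_sub hn q, hq]; linarith

theorem mem_range_tau_one_iff {n : ℕ} (hn : 1 ≤ n) (p : Gam n) :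
    p ∈ Set.range (tau n 1) ↔ bary p.1 0 ≤ bary p.1 ⟨1, by omega⟩ := by
  constructor
  · rintro ⟨q, rfl⟩
    have := bary_tau_one_sub hn q.1
    have := (mem_Gam_iff hn _).1 q.2 0
    rw [coe_tau]; linarith
  · intro h
    refine exists_tau_eq hn 1 p fun q hq => ?_
    rw [← bary_tau_one_sub hn q, hq]; linarith

theorem range_tau_union {n : ℕ} (hn : 1 ≤ n) :
    Set.range (tau n 0) ∪ Set.range (tau n 1) = Set.univ := by
  refine Set.eq_univ_of_forall fun p => ?_
  rw [Set.mem_union, mem_range_tau_zero_iff hn, mem_range_tau_one_iff hn]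
  exact le_total _ _

theorem exists_tau {n : ℕ} (hn : 1 ≤ n) (p : Gam n) : ∃ (a : Fin 2) (q : Gam n), tau n a q = p := by
  rcases (range_tau_union hn).symm ▸ Set.mem_univ p with ⟨q, h⟩ | ⟨q, h⟩
  exacts [⟨0, q, h⟩, ⟨1, q, h⟩]

/-- A common point satisfies both $x_0\ge x_1$ and $x_0\le x_1$, and the difference is, up to sign,
coordinate 0 of the preimage. -/
theorem bary_eq_zero_of_tau_eq_tau {n : ℕ} (hn : 1 ≤ n) {a b : Fin 2} {p q : Gam n} (hab : a ≠ b)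
    (h : tau n a p = tau n b q) : bary p.1 0 = 0 := by
  have hp := (mem_Gam_iff hn _).1 p.2 0
  have hq := (mem_Gam_iff hn _).1 q.2 0
  have h' := congrArg Subtype.val h
  rw [coe_tau, coe_tau] at h'
  fin_cases a <;> fin_cases b <;> simp at hab h'
  · rw [← bary_tau_zero_sub hn, h'] at hp ⊢
    rw [← bary_tau_one_sub hn] at hq
    linarith
  · rw [← bary_tau_one_sub hn, h'] at hp ⊢
    rw [← bary_tau_zero_sub hn] at hq
    linarith

theorem tau_zero_ne_tau_one {n : ℕ} (hn : 1 ≤ n) {p q : Gam n} (hp : p ∈ GamO n) :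
    tau n 0 p ≠ tau n 1 q := fun h =>
  ((mem_GamO_iff hn p).1 hp).ne' (bary_eq_zero_of_tau_eq_tau hn (by decide) h)

/-- Choosing at each step a half that contains the current point, and pulling the point back,
produces an itinerary; its letters are the digits of an address. -/
theorem upsilon_surjective {n : ℕ} (hn : 1 ≤ n) : Function.Surjective (upsilon n) := by
  intro p
  choose d f hf using exists_tau (n := n) hn
  obtain ⟨a, ha⟩ := exists_digit_eq fun t => d (f^[t] p)
  refine ⟨a, (eq_upsilon hn a fun t => ?_).symm⟩
  rw [ha]
  refine ⟨f^[t] p, ?_⟩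
  induction t with
  | zero => rfl
  | succ t ih => rw [tauWord, Function.comp_apply, Function.iterate_succ_apply', hf, ih]

/-! ### The map `K` -/

theorem eq_upsilon_of_tau_eq {n : ℕ} (hn : 1 ≤ n) {e : Fin 2} {p : Gam n} {c : ℤ_[2]}
    (hp : tau n e p = p) (hc : (e.val : ℤ_[2]) + 2 * c = c) : p = upsilon n c := by
  refine eq_upsilon hn c fun t => ?_
  induction t with
  | zero => exact ⟨p, rfl⟩
  | succ t ih =>
    rw [← hc, cell_digit_succ]
    exact ⟨p, ih, hp⟩

theorem tau_zero_v0 {n : ℕ} (hn : 1 ≤ n) : tau n 0 (v0 n) = v0 n :=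
  Subtype.ext ((coe_tau n 0 _).trans (tauAff_vertex_zero hn 0))

theorem tau_one_upsilon_neg_one {n : ℕ} (hn : 1 ≤ n) :
    tau n 1 (upsilon n (-1)) = upsilon n (-1) := by
  rw [← upsilon_two_mul_add_one hn]; norm_num

/-- The last homogeneous coordinate forces the eigenvalue to be 1, so the point is fixed by `tau n
1`; all its digits may be taken to be 1, which is the expansion of -1. -/
theorem isVNegOne_iff {n : ℕ} (hn : 1 ≤ n) (p : Gam n) : IsVNegOne n p ↔ p = upsilon n (-1) := by
  constructor
  · rintro ⟨c, hc⟩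
    rw [← hom_tau n hn] at hc
    have h1 := congrFun hc (Fin.last n)
    rw [Pi.smul_apply, hom_last, hom_last, smul_eq_mul, mul_one] at h1
    rw [← h1, one_smul] at hc
    refine eq_upsilon_of_tau_eq hn (e := 1) (Subtype.ext (funext fun i => ?_)) (by norm_num)
    rw [← hom_castSucc (tau n 1 p).1, hc, hom_castSucc]
  · rintro rfl
    exact ⟨1, by rw [← hom_tau n hn, tau_one_upsilon_neg_one hn, one_smul]⟩

/-- Since `tau n 0` maps `GamO n` off the range of `tau n 1`, the number of leading applications of
`tau n 1` is determined; injectivity gives the rest. This makes the choice in `K` immaterial. -/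
theorem piece_index_unique {n : ℕ} (hn : 1 ≤ n) {q r : Gam n} (hq : q ∈ GamO n) (hr : r ∈ GamO n)
    (k l : ℕ) (h : (tau n 1)^[k] (tau n 0 q) = (tau n 1)^[l] (tau n 0 r)) : k = l ∧ q = r := by
  induction k generalizing l with
  | zero =>
    cases l with
    | zero => exact ⟨rfl, tau_injective hn 0 h⟩
    | succ l =>
      rw [Function.iterate_succ_apply'] at h
      exact (tau_zero_ne_tau_one hn hq h).elim
  | succ k ih =>
    cases l with
    | zero =>
      rw [Function.iterate_succ_apply'] at h
      exact (tau_zero_ne_tau_one hn hr h.symm).elim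
    | succ l =>
      rw [Function.iterate_succ_apply', Function.iterate_succ_apply'] at h
      obtain ⟨h1, h2⟩ := ih l (tau_injective hn 1 h)
      exact ⟨congrArg (· + 1) h1, h2⟩

theorem iterate_ne_upsilon_neg_one {n : ℕ} (hn : 1 ≤ n) {q : Gam n} (hq : q ∈ GamO n) (k : ℕ) :
    (tau n 1)^[k] (tau n 0 q) ≠ upsilon n (-1) := by
  induction k with
  | zero =>
    intro h
    rw [← tau_one_upsilon_neg_one hn] at h
    exact tau_zero_ne_tau_one hn hq h
  | succ k ih =>
    intro h
    rw [← tau_one_upsilon_neg_one hn, Function.iterate_succ_apply'] at h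
    exact ih (tau_injective hn 1 h)

theorem K_piece {n : ℕ} (hn : 1 ≤ n) {q : Gam n} (hq : q ∈ GamO n) (k : ℕ) :
    K n ((tau n 1)^[k] (tau n 0 q)) = (tau n 0)^[k] (tau n 1 q) := by
  have hex : ∃ kq : ℕ × Gam n, kq.2 ∈ GamO n ∧
      (tau n 1)^[kq.1] (tau n 0 kq.2) = (tau n 1)^[k] (tau n 0 q) := ⟨(k, q), hq, rfl⟩
  rw [K, if_neg (mt (isVNegOne_iff hn _).1 (iterate_ne_upsilon_neg_one hn hq k)), dif_pos hex]
  obtain ⟨h1, h2⟩ := piece_index_unique hn hex.choose_spec.1 hq _ _ hex.choose_spec.2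
  rw [h1, h2]

theorem K_upsilon_neg_one {n : ℕ} (hn : 1 ≤ n) : K n (upsilon n (-1)) = v0 n := by
  rw [K, if_pos ((isVNegOne_iff hn _).2 rfl)]

/-- A point in no piece lies in the range of `tau n 1`, and its preimage again lies in no piece. It
therefore belongs to every cell of the address -1. -/
theorem eq_upsilon_neg_one_or_mem_piece {n : ℕ} (hn : 1 ≤ n) (p : Gam n) :
    p = upsilon n (-1) ∨ ∃ k, p ∈ piece n k := by
  refine or_iff_not_imp_right.2 fun h => eq_upsilon hn _ fun t => ?_
  induction t generalizing p with
  | zero => exact ⟨p, rfl⟩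
  | succ t ih =>
    have h1 : p ∈ Set.range (tau n 1) := by
      rw [mem_range_tau_one_iff hn]
      by_contra hlt
      obtain ⟨q, rfl⟩ := (mem_range_tau_zero_iff hn p).2 (not_le.1 hlt).le
      refine h ⟨0, q, ?_, rfl⟩
      rw [mem_GamO_iff hn, ← bary_tau_zero_sub hn, ← coe_tau]
      linarith
    obtain ⟨q, rfl⟩ := h1
    have h2 : (((1 : Fin 2).val : ℤ_[2]) + 2 * (-1)) = -1 := by norm_num
    rw [← h2, cell_digit_succ]
    refine ⟨q, ih q ?_, rfl⟩
    rintro ⟨k, r, hr, rfl⟩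
    exact h ⟨k + 1, r, hr, Function.iterate_succ_apply' _ _ _⟩

theorem K_tau_zero {n : ℕ} (hn : 1 ≤ n) {q : Gam n} (hq : q ∈ GamO n) :
    K n (tau n 0 q) = tau n 1 q := K_piece hn hq 0

/-- This is the carry rule. It also holds at $v_{-1}$, since $\tau_1v_{-1}=v_{-1}$, $Kv_{-1}=v_0$
and $\tau_0v_0=v_0$. -/
theorem K_tau_one {n : ℕ} (hn : 1 ≤ n) (p : Gam n) : K n (tau n 1 p) = tau n 0 (K n p) := by
  rcases eq_upsilon_neg_one_or_mem_piece hn p with rfl | ⟨k, q, hq, rfl⟩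
  · rw [tau_one_upsilon_neg_one hn, K_upsilon_neg_one hn, tau_zero_v0 hn]
  · change K n (tau n 1 ((tau n 1)^[k] (tau n 0 q))) = tau n 0 (K n ((tau n 1)^[k] (tau n 0 q)))
    rw [← Function.iterate_succ_apply' (tau n 1), K_piece hn hq, K_piece hn hq,
      Function.iterate_succ_apply']

theorem exists_affine_eqOn_piece {n : ℕ} (hn : 1 ≤ n) (k : ℕ) :
    ∃ L : (Fin n → ℝ) →ᵃ[ℝ] (Fin n → ℝ),
      (LinearMap.det L.linear = 1 ∨ LinearMap.det L.linear = -1) ∧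
      ∀ p ∈ piece n k, (K n p : Fin n → ℝ) = L p := by
  have hiter : ∀ (a b : Fin 2) (k : ℕ) (q : Gam n),
      ((tau n a)^[k] (tau n b q) : Fin n → ℝ) = (tauEquiv hn a ^ k * tauEquiv hn b) q.1 := by
    intro a b k q
    induction k with
    | zero => simp [coe_tau_eq_tauEquiv hn]
    | succ k ih =>
      rw [Function.iterate_succ_apply', coe_tau_eq_tauEquiv hn, ih, pow_succ', mul_assoc]
      rfl
  -- With $d=\det\tau_0$ and $\det\tau_1=rd$, both words contain $k+1$ factors $d$; these cancel and
  -- leave $r\,r^{-k}=\pm1$.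
  set e := tauEquiv hn 0 ^ k * tauEquiv hn 1 * (tauEquiv hn 1 ^ k * tauEquiv hn 0)⁻¹ with he
  refine ⟨e, ?_, ?_⟩
  · obtain ⟨r, hr, h⟩ := exists_det_tauEquiv hn
    have hdet : LinearEquiv.det e.linear = r * (r ^ k)⁻¹ := by
      change LinearEquiv.det (AffineEquiv.linearHom e) = _
      change LinearEquiv.det (AffineEquiv.linearHom (tauEquiv hn 1)) =
        r * LinearEquiv.det (AffineEquiv.linearHom (tauEquiv hn 0)) at h
      simp only [he, map_mul, map_pow, map_inv, h]
      rw [mul_pow]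
      generalize LinearEquiv.det (AffineEquiv.linearHom (tauEquiv hn 0)) = d
      rw [mul_inv, mul_inv]
      calc d ^ k * (r * d) * ((r ^ k)⁻¹ * (d ^ k)⁻¹ * d⁻¹)
          = r * (r ^ k)⁻¹ * ((d ^ k * (d ^ k)⁻¹) * (d * d⁻¹)) := by
            simp only [mul_assoc, mul_left_comm, mul_comm]
        _ = _ := by simp
    have hdet' : LinearMap.det (e : (Fin n → ℝ) →ᵃ[ℝ] (Fin n → ℝ)).linear =
        ((r * (r ^ k)⁻¹ : ℝˣ) : ℝ) := by
      rw [← hdet, LinearEquiv.coe_det]; rfl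
    rw [hdet']
    rcases hr with rfl | rfl
    · left; simp
    · rcases neg_one_pow_eq_or ℝˣ k with h | h <;> simp [h]
  · rintro _ ⟨q, hq, rfl⟩
    change ((K n ((tau n 1)^[k] (tau n 0 q)) : Gam n) : Fin n → ℝ) =
      e ((tau n 1)^[k] (tau n 0 q) : Gam n)
    rw [K_piece hn hq, hiter, hiter, he]
    change _ = (tauEquiv hn 0 ^ k * tauEquiv hn 1 * (tauEquiv hn 1 ^ k * tauEquiv hn 0)⁻¹ *
      (tauEquiv hn 1 ^ k * tauEquiv hn 0)) q.1
    rw [inv_mul_cancel_right]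

/-! ### The exceptional set -/

/-- The union of the boundaries of the simplexes `τ_{a_0} ⋯ τ_{a_{t-1}} Γ`, for all words of
length `t`. -/
def cellBoundary (n : ℕ) : ℕ → Set (Gam n)
  | 0 => {p | ∃ j, bary p.1 j = 0}
  | t + 1 => ⋃ a, tau n a '' cellBoundary n t

/-- The union of the boundaries of all simplexes `τ_{a_0} ⋯ τ_{a_{t-1}} Γ`. -/
def skeleton (n : ℕ) : Set (Gam n) := ⋃ t, cellBoundary n t

theorem mem_skeleton_of_bary_eq_zero {n : ℕ} {p : Gam n} {j : Fin (n + 1)} (h : bary p.1 j = 0) :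
    p ∈ skeleton n := Set.mem_iUnion.2 ⟨0, j, h⟩

theorem mem_GamO_of_notMem_skeleton {n : ℕ} (hn : 1 ≤ n) {p : Gam n} (h : p ∉ skeleton n) :
    p ∈ GamO n :=
  (mem_GamO_iff hn p).2 (((mem_Gam_iff hn _).1 p.2 0).lt_of_ne'
    fun h0 => h (mem_skeleton_of_bary_eq_zero h0))

/-- Interior points go to interior points because positive coordinates stay positive. A boundary
point of a deeper cell either has its preimage on a boundary one level up, or lies in the other half
too and so on the common face. -/
theorem tau_mem_skeleton_iff {n : ℕ} (hn : 1 ≤ n) (a : Fin 2) (q : Gam n) :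
    tau n a q ∈ skeleton n ↔ q ∈ skeleton n := by
  constructor
  · intro h
    obtain ⟨t, ht⟩ := Set.mem_iUnion.1 h
    cases t with
    | zero =>
      by_contra hq
      have hpos : ∀ j, 0 < bary q.1 j := fun j => ((mem_Gam_iff hn _).1 q.2 j).lt_of_ne'
        fun h0 => hq (mem_skeleton_of_bary_eq_zero h0)
      obtain ⟨j, hj⟩ := ht
      rw [bary_tau hn] at hj
      have h0 := hpos 0
      have hl := hpos (Fin.last n)
      rcases Nat.eq_zero_or_pos j.val with hj0 | hj0
      · rw [show j = 0 from Fin.ext hj0, B_mulVec_zero hn] at hj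
        split_ifs at hj <;> linarith
      · rcases Nat.lt_or_ge 1 j.val with h1 | h1
        · have := hpos ⟨j.val - 1, by omega⟩
          rw [← B_mulVec_succ (bary q.1) a (j.val - 1) (by omega) (by omega)] at this
          refine this.ne' ?_
          rw [← hj]
          congr 1
          exact Fin.ext (by simp; omega)
        · rw [show j = ⟨1, by omega⟩ from Fin.ext (by simp; omega), B_mulVec_one hn] at hj
          split_ifs at hj <;> linarith
    | succ t =>
      obtain ⟨b, r, hr, hb⟩ := Set.mem_iUnion.1 ht
      rcases eq_or_ne a b with rfl | hab
      · rw [← tau_injective hn a hb]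
        exact Set.mem_iUnion.2 ⟨t, hr⟩
      · exact mem_skeleton_of_bary_eq_zero (bary_eq_zero_of_tau_eq_tau hn hab hb.symm)
  · intro h
    obtain ⟨t, ht⟩ := Set.mem_iUnion.1 h
    exact Set.mem_iUnion.2 ⟨t + 1, Set.mem_iUnion.2 ⟨a, q, ht, rfl⟩⟩

theorem iterate_tau_mem_skeleton_iff {n : ℕ} (hn : 1 ≤ n) (a : Fin 2) (k : ℕ) (q : Gam n) :
    (tau n a)^[k] q ∈ skeleton n ↔ q ∈ skeleton n := by
  induction k with
  | zero => rfl
  | succ k ih => rw [Function.iterate_succ_apply', tau_mem_skeleton_iff hn, ih]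

theorem v0_mem_skeleton {n : ℕ} (hn : 1 ≤ n) : v0 n ∈ skeleton n := by
  refine mem_skeleton_of_bary_eq_zero (j := ⟨1, by omega⟩) ?_
  rw [← vertex_zero, bary_vertex hn, Pi.single_apply, if_neg]
  simp [Fin.ext_iff]

theorem K_mem_skeleton_iff {n : ℕ} (hn : 1 ≤ n) {p : Gam n} (hp : p ≠ upsilon n (-1)) :
    K n p ∈ skeleton n ↔ p ∈ skeleton n := by
  obtain ⟨k, q, hq, rfl⟩ := (eq_upsilon_neg_one_or_mem_piece hn p).resolve_left hp
  change K n ((tau n 1)^[k] (tau n 0 q)) ∈ _ ↔ (tau n 1)^[k] (tau n 0 q) ∈ _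
  simp only [K_piece hn hq, iterate_tau_mem_skeleton_iff hn, tau_mem_skeleton_iff hn]

/-- At the first differing digit the shifted point would lie in both halves, hence come from the
face $x_0=0$; being off the skeleton passes to each shift. -/
theorem upsilon_inj_of_notMem_skeleton {n : ℕ} (hn : 1 ≤ n) {a b : ℤ_[2]}
    (ha : upsilon n a ∉ skeleton n) (h : upsilon n a = upsilon n b) : a = b := by
  refine digit_injective (funext fun t => ?_)
  induction t generalizing a b with
  | zero =>
    obtain ⟨e, a, rfl⟩ := exists_eq_add_two_mul a
    obtain ⟨f, b, rfl⟩ := exists_eq_add_two_mul b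
    rw [digit_add_two_mul_zero, digit_add_two_mul_zero]
    rw [upsilon_add_two_mul hn, upsilon_add_two_mul hn] at h
    rw [upsilon_add_two_mul hn, tau_mem_skeleton_iff hn] at ha
    by_contra hef
    exact ha (mem_skeleton_of_bary_eq_zero (bary_eq_zero_of_tau_eq_tau hn hef h))
  | succ t ih =>
    obtain ⟨e, a, rfl⟩ := exists_eq_add_two_mul a
    obtain ⟨f, b, rfl⟩ := exists_eq_add_two_mul b
    rw [digit_add_two_mul_succ, digit_add_two_mul_succ]
    rw [upsilon_add_two_mul hn, upsilon_add_two_mul hn] at h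
    rw [upsilon_add_two_mul hn, tau_mem_skeleton_iff hn] at ha
    by_cases hef : e = f
    · subst hef
      exact ih ha (tau_injective hn e h)
    · exact (ha (mem_skeleton_of_bary_eq_zero (bary_eq_zero_of_tau_eq_tau hn hef h))).elim

/-- Even numbers only change their last digit, which matches $K\tau_0=\tau_1$. For odd numbers the
carry rule moves the question to $b$, one level less deep, so the induction is on the depth of the
cell and also covers $a=-1$. -/
theorem K_upsilon {n : ℕ} (hn : 1 ≤ n) {a : ℤ_[2]} (ha : upsilon n a ∉ skeleton n) :
    K n (upsilon n a) = upsilon n (a + 1) := by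
  refine eq_upsilon hn _ fun t => ?_
  induction t generalizing a with
  | zero => exact ⟨_, rfl⟩
  | succ t ih =>
    obtain ⟨e, b, rfl⟩ := exists_eq_add_two_mul a
    rw [upsilon_add_two_mul hn, tau_mem_skeleton_iff hn] at ha
    rw [upsilon_add_two_mul hn]
    fin_cases e
    · have h : (((0 : Fin 2).val : ℤ_[2]) + 2 * b + 1) = ((1 : Fin 2).val : ℤ_[2]) + 2 * b := by
        simp [add_comm]
      change K n (tau n 0 _) ∈ cell n (digit (((0 : Fin 2).val : ℤ_[2]) + 2 * b + 1)) _
      rw [K_tau_zero hn (mem_GamO_of_notMem_skeleton hn ha), h, cell_digit_succ]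
      exact ⟨_, upsilon_mem_cell hn b t, rfl⟩
    · have h : (((1 : Fin 2).val : ℤ_[2]) + 2 * b + 1) =
          ((0 : Fin 2).val : ℤ_[2]) + 2 * (b + 1) := by
        simp; ring
      change K n (tau n 1 _) ∈ cell n (digit (((1 : Fin 2).val : ℤ_[2]) + 2 * b + 1)) _
      rw [K_tau_one hn, h, cell_digit_succ]
      exact ⟨_, ih ha, rfl⟩

/-- The exceptional set: the skeleton, together with the orbit of `v_{-1}`. -/
def exceptional (n : ℕ) : Set (Gam n) := skeleton n ∪ Set.range fun m : ℤ => upsilon n m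

/-- The skeleton alone is not known to be invariant at $v_{-1}$, whose image $v_0$ lies in it.
Adding the points $\upsilon(m)$, $m\in\mathbb Z$, restores invariance, since `K` acts on their
addresses by $m\mapsto m+1$ off the skeleton. -/
theorem K_preimage_exceptional {n : ℕ} (hn : 1 ≤ n) : K n ⁻¹' exceptional n = exceptional n := by
  ext p
  rw [Set.mem_preimage]
  by_cases hv : p = upsilon n (-1)
  · subst hv
    rw [K_upsilon_neg_one hn]
    exact iff_of_true (Or.inl (v0_mem_skeleton hn)) (Or.inr ⟨-1, by simp⟩)
  have hK := K_mem_skeleton_iff hn hv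
  by_cases hp : p ∈ skeleton n
  · exact iff_of_true (Or.inl (hK.2 hp)) (Or.inl hp)
  obtain ⟨a, rfl⟩ := upsilon_surjective hn p
  have hK' := mt hK.1 hp
  rw [exceptional, Set.mem_union, Set.mem_union, or_iff_right hK', or_iff_right hp]
  rw [K_upsilon hn hp] at hK' ⊢
  constructor
  · rintro ⟨m, hm⟩
    have := upsilon_inj_of_notMem_skeleton hn hK' hm.symm
    exact ⟨m - 1, by simp [← this]⟩
  · rintro ⟨m, hm⟩
    have := upsilon_inj_of_notMem_skeleton hn hp hm.symm
    exact ⟨m + 1, by simp [← this]⟩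

/-! ### Lebesgue measure on `Γ` -/

theorem volume_image_affineMap {n : ℕ} (f : (Fin n → ℝ) →ᵃ[ℝ] (Fin n → ℝ)) (S : Set (Fin n → ℝ)) :
    volume (f '' S) = ENNReal.ofReal |LinearMap.det f.linear| * volume S := by
  have h : f '' S = (fun x => x + f 0) '' (f.linear '' S) := by
    rw [Set.image_image]
    exact Set.image_congr' fun x => congrFun f.decomp x
  rw [h, Set.image_add_right, measure_preimage_add_right, Measure.addHaar_image_linearMap]

theorem volume_bary_eq_zero {n : ℕ} (hn : 1 ≤ n) (j : Fin (n + 1)) :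
    volume {p : Fin n → ℝ | bary p j = 0} = 0 := by
  set s : AffineSubspace ℝ (Fin n → ℝ) :=
    (⊥ : Submodule ℝ ℝ).toAffineSubspace.comap
      ((LinearMap.proj j : (Fin (n + 1) → ℝ) →ₗ[ℝ] ℝ).toAffineMap.comp (baryAff n)) with hs
  have hset : {p : Fin n → ℝ | bary p j = 0} = s := by
    ext p
    simp [hs, baryAff_apply]
  rw [hset]
  refine Measure.addHaar_affineSubspace _ _ fun htop => ?_
  -- The vertex `vertex n j` has `j`th coordinate 1, so the affine subspace is proper.
  have h1 : vertex n j ∈ (s : Set (Fin n → ℝ)) := by rw [htop]; trivial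
  rw [← hset, Set.mem_ofPred_eq, bary_vertex hn] at h1
  simp at h1

theorem volume_Gam_ne_zero {n : ℕ} (hn : 1 ≤ n) : volume (Gam n) ≠ 0 := by
  have hopen : IsOpen {p : Fin n → ℝ | ∀ j, 0 < bary p j} := by
    simp only [Set.ofPred_forall]
    exact isOpen_iInter_of_finite fun j =>
      isOpen_lt continuous_const ((continuous_apply j).comp (continuous_bary n))
  have hne : {p : Fin n → ℝ | ∀ j, 0 < bary p j}.Nonempty := by
    refine ⟨ofBary fun _ => 1 / (n + 1 : ℝ), fun j => ?_⟩
    rw [bary_ofBary hn]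
    · positivity
    · simp only [Finset.sum_const, Finset.card_univ, Fintype.card_fin, nsmul_eq_mul]
      push_cast
      field_simp
  have hsub : {p : Fin n → ℝ | ∀ j, 0 < bary p j} ⊆ Gam n := fun p hp =>
    (mem_Gam_iff hn p).2 fun j => (hp j).le
  exact ((hopen.measure_pos volume hne).trans_le (measure_mono hsub)).ne'

theorem volume_Gam_ne_top (n : ℕ) : volume (Gam n) ≠ ⊤ := (isCompact_Gam n).measure_ne_top

theorem measurableSet_Gam (n : ℕ) : MeasurableSet (Gam n) := (isCompact_Gam n).measurableSet

theorem lam_apply {n : ℕ} (S : Set (Gam n)) :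
    lam n S = (volume (Gam n))⁻¹ * volume (Subtype.val '' S) := by
  rw [lam, Measure.smul_apply, comap_subtype_coe_apply (measurableSet_Gam n), smul_eq_mul]

theorem isProbabilityMeasure_lam {n : ℕ} (hn : 1 ≤ n) : IsProbabilityMeasure (lam n) := by
  refine ⟨?_⟩
  rw [lam_apply, Set.image_univ, Subtype.range_val]
  exact ENNReal.inv_mul_cancel (volume_Gam_ne_zero hn) (volume_Gam_ne_top n)

theorem lam_bary_eq_zero {n : ℕ} (hn : 1 ≤ n) (j : Fin (n + 1)) :
    lam n {p | bary p.1 j = 0} = 0 := by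
  have h : volume (Subtype.val '' {p : Gam n | bary p.1 j = 0}) = 0 := by
    refine measure_mono_null ?_ (volume_bary_eq_zero hn j)
    rintro _ ⟨p, hp, rfl⟩
    exact hp
  rw [lam_apply, h, mul_zero]

theorem lam_countable {n : ℕ} (hn : 1 ≤ n) {S : Set (Gam n)} (hS : S.Countable) :
    lam n S = 0 := by
  have : Nonempty (Fin n) := ⟨⟨0, hn⟩⟩
  rw [lam_apply, (hS.image _).measure_zero, mul_zero]

theorem lam_image_tau_eq_det {n : ℕ} (hn : 1 ≤ n) (a : Fin 2) (S : Set (Gam n)) :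
    lam n (tau n a '' S) = ENNReal.ofReal |LinearMap.det (tauAff n 0).linear| * lam n S := by
  have h : Subtype.val '' (tau n a '' S) = tauAff n a '' (Subtype.val '' S) := by
    rw [Set.image_image, Set.image_image]
    exact Set.image_congr' (coe_tau n a)
  rw [lam_apply, lam_apply, h, volume_image_affineMap, abs_det_tauAff hn, mul_left_comm]

theorem measurableSet_range_tau (n : ℕ) (a : Fin 2) : MeasurableSet (Set.range (tau n a)) :=
  (isCompact_range (continuous_tau n a)).measurableSet

/-- The two halves cover the simplex, overlap in a null face, and scale measure by the same factor,
so no determinant has to be computed. -/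
theorem ofReal_abs_det_tauAff {n : ℕ} (hn : 1 ≤ n) :
    ENNReal.ofReal |LinearMap.det (tauAff n 0).linear| = 2⁻¹ := by
  have := isProbabilityMeasure_lam hn
  have hnull : lam n (Set.range (tau n 0) ∩ Set.range (tau n 1)) = 0 := by
    have hsub : Set.range (tau n 0) ∩ Set.range (tau n 1) ⊆
        tau n 0 '' {p | bary p.1 0 = 0} := by
      rintro _ ⟨⟨p, rfl⟩, q, hq⟩
      exact ⟨p, bary_eq_zero_of_tau_eq_tau hn (by decide) hq.symm, rfl⟩
    refine measure_mono_null hsub ?_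
    rw [lam_image_tau_eq_det hn, lam_bary_eq_zero hn, mul_zero]
  have h := measure_union_add_inter (μ := lam n) (Set.range (tau n 0))
    (measurableSet_range_tau n 1)
  rw [hnull, range_tau_union hn, ← Set.image_univ, ← Set.image_univ, lam_image_tau_eq_det hn,
    lam_image_tau_eq_det hn, measure_univ, add_zero, mul_one, ← two_mul] at h
  exact ENNReal.eq_inv_of_mul_eq_one_left (by rw [mul_comm]; exact h.symm)

theorem lam_image_tau {n : ℕ} (hn : 1 ≤ n) (a : Fin 2) (S : Set (Gam n)) :
    lam n (tau n a '' S) = 2⁻¹ * lam n S := by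
  rw [lam_image_tau_eq_det hn, ofReal_abs_det_tauAff hn]

theorem lam_cell {n : ℕ} (hn : 1 ≤ n) (a : ℕ → Fin 2) (t : ℕ) : lam n (cell n a t) = 2⁻¹ ^ t := by
  have := isProbabilityMeasure_lam hn
  induction t generalizing a with
  | zero =>
    rw [cell, tauWord, Set.range_id, measure_univ, pow_zero]
  | succ t ih =>
    rw [cell, tauWord_succ', Set.range_comp, lam_image_tau hn, pow_succ', ← ih, cell]

theorem isClosed_cellBoundary {n : ℕ} (t : ℕ) : IsClosed (cellBoundary n t) := by
  induction t with
  | zero =>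
    have : cellBoundary n 0 = ⋃ j, {p : Gam n | bary p.1 j = 0} := by
      ext p; simp [cellBoundary]
    rw [this]
    exact isClosed_iUnion_of_finite fun j => isClosed_eq
      ((continuous_apply j).comp ((continuous_bary n).comp continuous_subtype_val))
      continuous_const
  | succ t ih =>
    exact isClosed_iUnion_of_finite fun a => (ih.isCompact.image (continuous_tau n a)).isClosed

theorem lam_cellBoundary {n : ℕ} (hn : 1 ≤ n) (t : ℕ) : lam n (cellBoundary n t) = 0 := by
  induction t with
  | zero =>
    have : cellBoundary n 0 = ⋃ j, {p : Gam n | bary p.1 j = 0} := by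
      ext p; simp [cellBoundary]
    rw [this]
    exact measure_iUnion_null (lam_bary_eq_zero hn)
  | succ t ih =>
    exact measure_iUnion_null fun a => by rw [lam_image_tau hn, ih, mul_zero]

theorem measurableSet_exceptional (n : ℕ) : MeasurableSet (exceptional n) :=
  (MeasurableSet.iUnion fun t => (isClosed_cellBoundary t).measurableSet).union
    (Set.countable_range _).measurableSet

theorem lam_exceptional {n : ℕ} (hn : 1 ≤ n) : lam n (exceptional n) = 0 :=
  measure_union_null (measure_iUnion_null (lam_cellBoundary hn))
    (lam_countable hn (Set.countable_range _))

theorem measurableSet_GamO {n : ℕ} (hn : 1 ≤ n) : MeasurableSet (GamO n) := by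
  have : GamO n = {p : Gam n | 0 < bary p.1 0} := Set.ext (mem_GamO_iff hn)
  rw [this]
  exact (isOpen_lt continuous_const
    ((continuous_apply 0).comp ((continuous_bary n).comp continuous_subtype_val))).measurableSet

instance (n : ℕ) : StandardBorelSpace (Gam n) := (measurableSet_Gam n).standardBorel

/-- The preimage splits over the countably many pieces. On each it is the image of a Borel set under
an injective continuous map, hence Borel by the Lusin–Souslin theorem. -/
theorem measurable_K {n : ℕ} (hn : 1 ≤ n) : Measurable (K n) := by
  intro S hS
  have h : K n ⁻¹' S = ({upsilon n (-1)} ∩ K n ⁻¹' S) ∪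
      ⋃ k, (fun q => (tau n 1)^[k] (tau n 0 q)) ''
        (GamO n ∩ (fun q => (tau n 0)^[k] (tau n 1 q)) ⁻¹' S) := by
    ext p
    constructor
    · intro hp
      rcases eq_upsilon_neg_one_or_mem_piece hn p with rfl | ⟨k, q, hq, rfl⟩
      · exact Or.inl ⟨rfl, hp⟩
      · refine Or.inr (Set.mem_iUnion.2 ⟨k, q, ⟨hq, ?_⟩, rfl⟩)
        rw [Set.mem_preimage, ← K_piece hn hq]
        exact hp
    · rintro (h | h)
      · exact h.2
      · obtain ⟨k, q, ⟨hq, hS⟩, rfl⟩ := Set.mem_iUnion.1 h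
        rw [Set.mem_preimage, K_piece hn hq]
        exact hS
  rw [h]
  refine MeasurableSet.union ((Set.subsingleton_singleton.anti
    Set.inter_subset_left).measurableSet) (MeasurableSet.iUnion fun k => ?_)
  have hc : ∀ (a b : Fin 2) (k : ℕ), Continuous fun q => (tau n a)^[k] (tau n b q) := fun a b k =>
    ((continuous_tau n a).iterate k).comp (continuous_tau n b)
  exact ((hc 1 0 k).measurableEmbedding (((tau_injective hn 1).iterate k).comp
    (tau_injective hn 0))).measurableSet_image'
    ((measurableSet_GamO hn).inter ((hc 0 1 k).measurable hS))

/-! ### Haar measure on `ℤ_2` -/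

/-- The residue class of `a` modulo `2^t`. -/
def residueClass (a : ℤ_[2]) (t : ℕ) : Set ℤ_[2] := {b | (2 : ℤ_[2]) ^ t ∣ b - a}

theorem residueClass_eq_closedBall (a : ℤ_[2]) (t : ℕ) :
    residueClass a t = Metric.closedBall a ((1 / 2) ^ t) := by
  ext b
  rw [residueClass, Set.mem_ofPred_eq, ← digits_eq_iff_dvd, digits_eq_iff_dist_le]
  rfl

theorem isOpen_residueClass (a : ℤ_[2]) (t : ℕ) : IsOpen (residueClass a t) := by
  rw [residueClass_eq_closedBall]
  exact IsUltrametricDist.isOpen_closedBall _ (by positivity)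

theorem residueClass_eq_of_mem {a b : ℤ_[2]} {t : ℕ} (h : b ∈ residueClass a t) :
    residueClass a t = residueClass b t := by
  ext c
  have : c - a = (c - b) + (b - a) := by ring
  rw [residueClass, residueClass, Set.mem_ofPred_eq, Set.mem_ofPred_eq, this, dvd_add_left h]

theorem residueClass_antitone (a : ℤ_[2]) : Antitone (residueClass a) := fun _ _ h _ hb =>
  (pow_dvd_pow _ h).trans hb

theorem isPiSystem_residueClass :
    IsPiSystem {S : Set ℤ_[2] | ∃ a t, S = residueClass a t} := by
  rintro _ ⟨a, s, rfl⟩ _ ⟨b, t, rfl⟩ ⟨c, hca, hcb⟩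
  rw [residueClass_eq_of_mem hca, residueClass_eq_of_mem hcb]
  rcases le_total s t with h | h
  · exact ⟨c, t, Set.inter_eq_right.2 (residueClass_antitone c h)⟩
  · exact ⟨c, s, Set.inter_eq_left.2 (residueClass_antitone c h)⟩

theorem isTopologicalBasis_residueClass :
    TopologicalSpace.IsTopologicalBasis {S : Set ℤ_[2] | ∃ a t, S = residueClass a t} := by
  refine TopologicalSpace.isTopologicalBasis_of_isOpen_of_nhds ?_ ?_
  · rintro _ ⟨a, t, rfl⟩
    exact isOpen_residueClass a t
  · intro a U ha hU
    obtain ⟨ε, hε, hball⟩ := Metric.isOpen_iff.1 hU a ha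
    obtain ⟨t, ht⟩ := exists_pow_lt_of_lt_one hε (show (1 / 2 : ℝ) < 1 by norm_num)
    refine ⟨_, ⟨a, t, rfl⟩, by simp [residueClass], ?_⟩
    rw [residueClass_eq_closedBall]
    exact (Metric.closedBall_subset_ball ht).trans hball

theorem measure_ext_residueClass {μ ν : Measure ℤ_[2]} [IsFiniteMeasure μ]
    (h : ∀ a t, μ (residueClass a t) = ν (residueClass a t)) : μ = ν := by
  refine ext_of_generate_finite _
    (BorelSpace.measurable_eq.trans isTopologicalBasis_residueClass.borel_eq_generateFrom)
    isPiSystem_residueClass ?_ ?_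
  · rintro _ ⟨a, t, rfl⟩
    exact h a t
  · have : (Set.univ : Set ℤ_[2]) = residueClass 0 0 := by ext; simp [residueClass]
    rw [this, h]

instance : haar.IsAddHaarMeasure := by unfold haar; infer_instance

theorem haar_univ : haar Set.univ = 1 := by
  simpa [haar] using Measure.addHaarMeasure_self (G := ℤ_[2]) (K₀ := ⊤)

/-- Each class modulo $2^t$ is the disjoint union of two classes modulo $2^{t+1}$, which are
translates of each other. -/
theorem haar_residueClass (t : ℕ) (a : ℤ_[2]) : haar (residueClass a t) = 2⁻¹ ^ t := by
  have htrans : ∀ (a b : ℤ_[2]) (t : ℕ), haar (residueClass a t) = haar (residueClass b t) := by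
    intro a b t
    rw [← measure_preimage_add haar (b - a) (residueClass b t)]
    congr 1
    ext c
    simp only [residueClass, Set.mem_ofPred_eq, Set.mem_preimage]
    rw [show b - a + c - b = c - a by ring]
  induction t generalizing a with
  | zero =>
    have : residueClass a 0 = Set.univ := by ext; simp [residueClass]
    rw [this, haar_univ, pow_zero]
  | succ t ih =>
    have hunion : residueClass a t = residueClass a (t + 1) ∪ residueClass (a + 2 ^ t) (t + 1) := by
      ext b
      simp only [residueClass, Set.mem_ofPred_eq, Set.mem_union]
      constructor
      · rintro ⟨c, hc⟩
        obtain ⟨e, d, rfl⟩ := exists_eq_add_two_mul c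
        fin_cases e
        · exact Or.inl ⟨d, by rw [hc]; push_cast; ring⟩
        · exact Or.inr ⟨d, by rw [← sub_sub, hc]; push_cast; ring⟩
      · rintro (⟨c, hc⟩ | ⟨c, hc⟩)
        · exact ⟨2 * c, by rw [hc]; ring⟩
        · exact ⟨1 + 2 * c, by linear_combination hc⟩
    have hdisj : Disjoint (residueClass a (t + 1)) (residueClass (a + 2 ^ t) (t + 1)) := by
      refine Set.disjoint_left.2 ?_
      rintro b ⟨c, hc⟩ ⟨d, hd⟩
      refine two_mul_padic_ne_one (c - d) (mul_left_cancel₀ (pow_ne_zero t two_ne_zero) ?_)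
      linear_combination hd - hc
    have h := measure_union (μ := haar) hdisj (isOpen_residueClass _ _).measurableSet
    rw [← hunion, ih, htrans (a + 2 ^ t) a, ← two_mul] at h
    rw [pow_succ', h, ← mul_assoc, ENNReal.inv_mul_cancel two_ne_zero ENNReal.ofNat_ne_top, one_mul]

theorem measurePreserving_add_one : MeasurePreserving (fun a : ℤ_[2] => a + 1) haar haar :=
  measurePreserving_add_right haar 1

/-! ### The metric isomorphism -/

theorem exists_upsilon_eq_tauWord {n : ℕ} (hn : 1 ≤ n) (c : ℤ_[2]) (t : ℕ) (a : ℤ_[2]) :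
    ∃ b ∈ residueClass a t, upsilon n b = tauWord n (digit a) t (upsilon n c) := by
  induction t generalizing a with
  | zero => exact ⟨c, by simp [residueClass], rfl⟩
  | succ t ih =>
    obtain ⟨e, a, rfl⟩ := exists_eq_add_two_mul a
    obtain ⟨b, ⟨d, hd⟩, hb⟩ := ih a
    refine ⟨(e.val : ℤ_[2]) + 2 * b, ⟨d, ?_⟩, ?_⟩
    · rw [pow_succ]; linear_combination 2 * hd
    · rw [upsilon_add_two_mul hn, hb, tauWord_succ', digit_add_two_mul_zero]
      simp only [digit_add_two_mul_succ]
      rfl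

/-- Every point of a cell has some address beginning with the letters of that cell; off the skeleton
this is its only address. -/
theorem mem_cell_iff_of_notMem_skeleton {n : ℕ} (hn : 1 ≤ n) {b : ℤ_[2]}
    (hb : upsilon n b ∉ skeleton n) (a : ℤ_[2]) (t : ℕ) :
    upsilon n b ∈ cell n (digit a) t ↔ b ∈ residueClass a t := by
  constructor
  · rintro ⟨r, hr⟩
    obtain ⟨c, rfl⟩ := upsilon_surjective hn r
    obtain ⟨b', hb', h⟩ := exists_upsilon_eq_tauWord hn c t a
    rwa [upsilon_inj_of_notMem_skeleton hn hb (hr.symm.trans h.symm)]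
  · intro h
    have := upsilon_mem_cell hn b t
    rwa [cell, tauWord_congr ((digits_eq_iff_dvd t b a).2 h)] at this

section Iso

variable {n : ℕ} (hn : 1 ≤ n)

-- Off the exceptional set $\upsilon$ is a continuous bijection between standard Borel spaces, so
-- its inverse is Borel by Lusin–Souslin.
include hn in
theorem exists_measurableEquiv_upsilon :
    ∃ e : (upsilon n ⁻¹' (exceptional n)ᶜ : Set ℤ_[2]) ≃ᵐ ((exceptional n)ᶜ : Set (Gam n)),
      ∀ x, (e x : Gam n) = upsilon n x := by
  have hY : MeasurableSet (exceptional n)ᶜ := (measurableSet_exceptional n).compl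
  have hX : MeasurableSet (upsilon n ⁻¹' (exceptional n)ᶜ) :=
    (continuous_upsilon hn).measurable hY
  have : StandardBorelSpace (upsilon n ⁻¹' (exceptional n)ᶜ : Set ℤ_[2]) := hX.standardBorel
  let f : (upsilon n ⁻¹' (exceptional n)ᶜ : Set ℤ_[2]) → ((exceptional n)ᶜ : Set (Gam n)) :=
    fun x => ⟨upsilon n x, x.2⟩
  have hf : Measurable f :=
    ((continuous_upsilon hn).measurable.comp measurable_subtype_coe).subtype_mk
  have hinj : Function.Injective f := fun x y h => Subtype.ext
    (upsilon_inj_of_notMem_skeleton hn (fun hs => x.2 (Or.inl hs)) (congrArg Subtype.val h))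
  have hsurj : Function.Surjective f := by
    rintro ⟨p, hp⟩
    obtain ⟨a, rfl⟩ := upsilon_surjective hn p
    exact ⟨⟨a, hp⟩, rfl⟩
  refine ⟨⟨Equiv.ofBijective f ⟨hinj, hsurj⟩, hf, fun S hS => ?_⟩, fun x => rfl⟩
  rw [← Equiv.image_eq_preimage_symm]
  exact (hf.measurableEmbedding hinj).measurableSet_image' hS

variable (e : (upsilon n ⁻¹' (exceptional n)ᶜ : Set ℤ_[2]) ≃ᵐ ((exceptional n)ᶜ : Set (Gam n)))
  (he : ∀ x, (e x : Gam n) = upsilon n x)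

include hn he in
/-- Lebesgue measure, transported to `ℤ_2` by the inverse of `υ`, is Haar measure. -/
theorem map_symm_lam :
    (((lam n).comap Subtype.val).map e.symm).map Subtype.val = haar := by
  have := isProbabilityMeasure_lam hn
  refine (measure_ext_residueClass (μ := haar) fun a t => ?_).symm
  rw [haar_residueClass, Measure.map_apply measurable_subtype_coe
    (isOpen_residueClass a t).measurableSet, Measure.map_apply e.symm.measurable
    (measurable_subtype_coe (isOpen_residueClass a t).measurableSet),
    comap_subtype_coe_apply (measurableSet_exceptional n).compl]
  -- Measures are compared on residue classes, which generate the Borel sets; their counterparts are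
  -- cells up to a null set.
  have h : Subtype.val '' (e.symm ⁻¹' (Subtype.val ⁻¹' residueClass a t)) =
      cell n (digit a) t \ exceptional n := by
    ext p
    constructor
    · rintro ⟨y, hy, rfl⟩
      refine ⟨?_, y.2⟩
      obtain ⟨x, rfl⟩ := e.surjective y
      rw [Set.mem_preimage, MeasurableEquiv.symm_apply_apply] at hy
      rw [he, mem_cell_iff_of_notMem_skeleton hn fun hs => x.2 (Or.inl hs)]
      exact hy
    · rintro ⟨hp, hpe⟩
      refine ⟨⟨p, hpe⟩, ?_, rfl⟩
      obtain ⟨x, hx⟩ := e.surjective ⟨p, hpe⟩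
      rw [← hx, Set.mem_preimage, MeasurableEquiv.symm_apply_apply, Set.mem_preimage,
        ← mem_cell_iff_of_notMem_skeleton hn fun hs => x.2 (Or.inl hs), ← he, hx]
      exact hp
  rw [h, measure_sdiff_null (lam_exceptional hn), lam_cell hn]

include hn in
theorem measurableSet_upsilon_preimage : MeasurableSet (upsilon n ⁻¹' (exceptional n)ᶜ) :=
  (continuous_upsilon hn).measurable (measurableSet_exceptional n).compl

include hn he in
theorem measurePreserving_equiv_upsilon :
    MeasurePreserving e (haar.comap Subtype.val) ((lam n).comap Subtype.val) := by
  refine MeasurePreserving.symm e.symm ⟨e.symm.measurable, ?_⟩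
  rw [← map_symm_lam hn e he, (MeasurableEmbedding.subtype_coe
    (measurableSet_upsilon_preimage hn)).comap_map]

-- Haar measure has just been expressed as an image of a measure carried by this very set, so its
-- complement is null.
include hn he in
theorem haar_compl_upsilon_preimage : haar (upsilon n ⁻¹' (exceptional n)ᶜ)ᶜ = 0 := by
  rw [← map_symm_lam hn e he, Measure.map_apply measurable_subtype_coe
    (measurableSet_upsilon_preimage hn).compl]
  exact measure_mono_null (fun x hx => hx x.2) measure_empty

include hn he in
theorem map_upsilon_haar : haar.map (upsilon n) = lam n := by
  have hυ := (continuous_upsilon hn).measurable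
  rw [← map_symm_lam hn e he, Measure.map_map hυ measurable_subtype_coe,
    Measure.map_map (hυ.comp measurable_subtype_coe) e.symm.measurable]
  have h : (upsilon n ∘ Subtype.val) ∘ e.symm = Subtype.val := by
    funext y
    rw [Function.comp_apply, Function.comp_apply, ← he, MeasurableEquiv.apply_symm_apply]
  rw [h, map_comap_subtype_coe (measurableSet_exceptional n).compl]
  exact Measure.restrict_eq_self_of_ae_mem (compl_mem_ae_iff.2 (lam_exceptional hn))

-- Since $\lambda=\upsilon_*\mu$ and $K\circ\upsilon=\upsilon\circ(+1)$ almost everywhere,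
-- $K_*\lambda=\upsilon_*(+1)_*\mu=\lambda$.
include hn he in
theorem measurePreserving_K : MeasurePreserving (K n) (lam n) (lam n) := by
  refine ⟨measurable_K hn, ?_⟩
  have hυ := (continuous_upsilon hn).measurable
  have hae : K n ∘ upsilon n =ᵐ[haar] upsilon n ∘ fun a => a + 1 := by
    filter_upwards [mem_ae_iff.2 (haar_compl_upsilon_preimage hn e he)] with a ha
    exact K_upsilon hn fun hs => ha (Or.inl hs)
  conv_lhs => rw [← map_upsilon_haar hn e he]
  rw [Measure.map_map (measurable_K hn) hυ, Measure.map_congr hae,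
    ← Measure.map_map hυ measurePreserving_add_one.measurable, measurePreserving_add_one.map_eq,
    map_upsilon_haar hn e he]

include hn in
theorem isMetricIso_upsilon :
    IsMetricIso haar (fun a => a + 1) (lam n) (K n) (upsilon n)
      (upsilon n ⁻¹' (exceptional n)ᶜ) (exceptional n)ᶜ := by
  obtain ⟨e, he⟩ := exists_measurableEquiv_upsilon hn
  have hK : ∀ a ∈ upsilon n ⁻¹' (exceptional n)ᶜ, upsilon n (a + 1) = K n (upsilon n a) :=
    fun a ha => (K_upsilon hn fun hs => ha (Or.inl hs)).symm
  have hKN : Set.MapsTo (K n) (exceptional n)ᶜ (exceptional n)ᶜ := fun p hp h =>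
    hp (by rw [← K_preimage_exceptional hn]; exact h)
  exact
    { preserving_source := measurePreserving_add_one
      preserving_target := measurePreserving_K hn e he
      measurableSet_source := measurableSet_upsilon_preimage hn
      measurableSet_target := (measurableSet_exceptional n).compl
      null_source := haar_compl_upsilon_preimage hn e he
      null_target := by rw [compl_compl]; exact lam_exceptional hn
      mapsTo_source := fun a ha => by
        rw [Set.mem_preimage, hK a ha]; exact hKN ha
      mapsTo_target := hKN
      equiv := ⟨e, he, measurePreserving_equiv_upsilon hn e he⟩
      intertwine := hK }

end Iso

end KvN

theorem mainTheorem4 (n : ℕ) (hn : 1 ≤ n) :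
    (∀ k : ℕ, ∃ L : (Fin n → ℝ) →ᵃ[ℝ] (Fin n → ℝ),
      (LinearMap.det L.linear = 1 ∨ LinearMap.det L.linear = -1) ∧
      ∀ p ∈ KvN.piece n k, (KvN.K n p : Fin n → ℝ) = L p) ∧
    MeasureTheory.MeasurePreserving (KvN.K n) (KvN.lam n) (KvN.lam n) ∧
    (∀ a : ℤ_[2], ⋂ t, KvN.cell n (KvN.digit a) t = {KvN.upsilon n a}) ∧
    ∃ N : Set (KvN.Gam n), MeasurableSet N ∧ KvN.lam n N = 0 ∧ KvN.K n ⁻¹' N = N ∧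
      KvN.IsMetricIso KvN.haar (fun a => a + 1) (KvN.lam n) (KvN.K n) (KvN.upsilon n)
        (KvN.upsilon n ⁻¹' Nᶜ) Nᶜ :=
  ⟨KvN.exists_affine_eqOn_piece hn, (KvN.isMetricIso_upsilon hn).preserving_target,
    KvN.iInter_cell_eq hn, KvN.exceptional n, KvN.measurableSet_exceptional n,
    KvN.lam_exceptional hn, KvN.K_preimage_exceptional hn, KvN.isMetricIso_upsilon hn⟩
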